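/- **Theorem (local convergence of AGQN).** *Setting.* Let $n\ge1$ and let $f:\mathbb R^n\to\mathbb R$ be twice differentiable with $\mu I\preceq\nabla^2f(x)\preceq\omega I$ and $\|\nabla^2f(y)-\nabla^2f(x)\|\le L\|y-x\|$ for all $x,y$, where $\mu,L>0$ (spectral norm). Put $\kappa=\omega/\mu$ and assume $n\kappa>1$. For positive definite $A$ write $\|h\|_A=\langle Ah,h\rangle^{1/2}$, $\|h\|_A^*=\langle A^{-1}h,h\rangle^{1/2}$ and $\sigma_A(G)=\operatorname{Trace}(A^{-1}(G-A))$. Let $M>0$ be a constant of strong self-concordancy of $f$, i.e. $\nabla^2f(y)-\nabla^2f(x)\preceq M\|y-x\|_{\nabla^2f(z)}\nabla^2f(w)$ for all $x,y,z,w$ (for instance $M=L/\mu^{3/2}$). Let $\tau\ge0$ be an integer and define $$\rho=1-\tfrac1{n\kappa},\quad \varepsilon_0=\tfrac1{2\kappa-1},\quad \sigma_\tau=\rho^\tau\varepsilon_0+n,\quad c_{\tau,\varepsilon_0}=-\frac{\sigma_\tau}{\sigma_\tau+n}+\frac{\sqrt{\rho\sigma_\tau^2+(\sigma_\tau+n)(1-\rho^{\tau+1})\varepsilon_0}}{\sqrt\rho\,(\sigma_\tau+n)},$$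 $$\beta(x)=\frac{L\|\nabla f(x)\|}{2\mu^2},\qquad \lambda(x)=\|\nabla f(x)\|^*_{\nabla^2f(x)},\qquad \bar\Phi_0=\varepsilon_0+\frac{n\ln2}{12n+2}.$$ *Greedy Broyden update.* For $u\in\mathbb R^n$ let $$\mathrm{SR1}(G,A,u)=G-\frac{(G-A)uu^{\mathsf T}(G-A)}{\langle(G-A)u,u\rangle},\quad \mathrm{DFP}(G,A,u)=G-\frac{Auu^{\mathsf T}G+Guu^{\mathsf T}A}{\langle Au,u\rangle}+\Big(\frac{\langle Gu,u\rangle}{\langle Au,u\rangle}+1\Big)\frac{Auu^{\mathsf T}A}{\langle Au,u\rangle}$$ (the SR1 correction is $0$ when its denominator vanishes). $\mathrm{gBroyd}(G,A)$ denotes $\phi\,\mathrm{DFP}(G,A,u)+(1-\phi)\,\mathrm{SR1}(G,A,u)$, where $u$ is any maximizer of $\langle Gu,u\rangle/\langle Au,u\rangle$ over the standard unit vectors $e_1,\dots,e_n$ and $\phi\in[0,1]$ may be chosen freely at every call. *The AGQN method.* From $(x^0,G^0)$, for $k\ge0$: set $$x^{k+1}=x^k-\alpha^k(G^k)^{-1}\nabla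 f(x^k),\qquad \alpha^k=\min\Big\{\frac{c_{\tau,\varepsilon_0}}{M\|\nabla f(x^k)\|^*_{G^k}},\ \frac1{4\beta(x^k)},\ 1\Big\}$$ (if $\nabla f(x^k)=0$ then $x^{k+1}=x^k$); let $\underline G^k$ be the result of $\tau$ successive updates $\mathrm{gBroyd}(\cdot,\nabla^2f(x^k))$ started at $G^k$; and set $$G^{k+1}=\mathrm{gBroyd}\big((1+Mr^{k+1})\underline G^k,\ \nabla^2f(x^{k+1})\big),\qquad r^{k+1}=\|x^{k+1}-x^k\|_{\nabla^2f(x^k)}.$$ *Claim.* Suppose $G^0\succeq\nabla^2f(x^0)$, $\sigma_{\nabla^2f(x^0)}(G^0)\le\varepsilon_0$ and $$\|\nabla f(x^0)\|\le\min\Big\{\frac{\sqrt\mu\,c_{\tau,\varepsilon_0}}{M},\ \frac{\mu^2}{2L}\Big\}.$$ Then every sequence of iterates of the AGQN method satisfies: 1. If $M\lambda(x^0)\le\frac14$, then $\lambda(x^{k+1})\le\frac34\lambda(x^k)$ for all $k\ge0$. 2. If $n\ge2$ and $M\lambda(x^0)\le\dfrac{\ln2}{8(6n+1)}$, then for all $k\ge0$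 $$\lambda(x^{k+1})\le\big(\max\{\rho^{\tau+1},\tfrac34\rho\}\big)^k\,2\bar\Phi_0\,\lambda(x^k).$$ -/

import Mathlib

open scoped Matrix Gradient

noncomputable section

namespace AGQN

variable {n : ℕ}

/-- The Hessian matrix of `f` at `x` in the standard basis: column `j` is the derivative of the
gradient in the direction `e_j`. -/
def hess (f : EuclideanSpace ℝ (Fin n) → ℝ) (x : EuclideanSpace ℝ (Fin n)) :
    Matrix (Fin n) (Fin n) ℝ :=
  Matrix.of fun i j => (fderiv ℝ (∇ f) x (EuclideanSpace.single j 1)) i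

/-- `A ⪯ B` in the Loewner order. -/
def Loewner (A B : Matrix (Fin n) (Fin n) ℝ) : Prop := (B - A).PosSemidef

/-- The weighted norm `‖h‖_A = ⟨A h, h⟩ ^ (1/2)`. -/
def wnorm (A : Matrix (Fin n) (Fin n) ℝ) (h : EuclideanSpace ℝ (Fin n)) : ℝ :=
  Real.sqrt (inner ℝ (Matrix.toEuclideanCLM (𝕜 := ℝ) A h) h)

/-- The dual weighted norm `‖h‖_A^* = ⟨A⁻¹ h, h⟩ ^ (1/2)`. -/
def dualNorm (A : Matrix (Fin n) (Fin n) ℝ) (h : EuclideanSpace ℝ (Fin n)) : ℝ :=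
  wnorm A⁻¹ h

/-- `f` is twice differentiable, `μ`-strongly convex and `ω`-smooth, and its Hessian is
`L`-Lipschitz in the spectral norm. -/
structure RegularObjective (f : EuclideanSpace ℝ (Fin n) → ℝ) (μ ω L : ℝ) : Prop where
  diff : Differentiable ℝ f
  diff_grad : Differentiable ℝ (∇ f)
  lower : ∀ x, Loewner (μ • (1 : Matrix (Fin n) (Fin n) ℝ)) (hess f x)
  upper : ∀ x, Loewner (hess f x) (ω • (1 : Matrix (Fin n) (Fin n) ℝ))
  lipschitz : ∀ x y, ‖Matrix.toEuclideanCLM (𝕜 := ℝ) (hess f y - hess f x)‖ ≤ L * ‖y - x‖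

/-- `f` is strongly self-concordant with constant `M`. -/
def StronglySelfConcordant (f : EuclideanSpace ℝ (Fin n) → ℝ) (M : ℝ) : Prop :=
  ∀ x y z w, Loewner (hess f y - hess f x) ((M * wnorm (hess f z) (y - x)) • hess f w)

lemma Loewner.quad_le {A B : Matrix (Fin n) (Fin n) ℝ} (h : Loewner A B)
    (v : EuclideanSpace ℝ (Fin n)) :
    inner ℝ v (Matrix.toEuclideanCLM (𝕜 := ℝ) A v) ≤
      inner ℝ v (Matrix.toEuclideanCLM (𝕜 := ℝ) B v) := by
  have h1 := Matrix.PosSemidef.dotProduct_mulVec_nonneg h v.ofLp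
  rw [Matrix.inner_toEuclideanCLM, Matrix.inner_toEuclideanCLM]
  simpa [Matrix.sub_mulVec, dotProduct_sub] using h1

/-- Constants of strong self-concordancy exist for every regular objective. -/
lemma RegularObjective.stronglySelfConcordant {f : EuclideanSpace ℝ (Fin n) → ℝ} {μ ω L : ℝ}
    (hf : RegularObjective f μ ω L) (hμ : 0 < μ) (hL : 0 ≤ L) :
    StronglySelfConcordant f (L / (μ * Real.sqrt μ)) := by
  have key : ∀ z v, μ * ‖v‖ ^ 2 ≤
      inner ℝ v (Matrix.toEuclideanCLM (𝕜 := ℝ) (hess f z) v) := by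
    intro z v
    have h := (hf.lower z).quad_le v
    rw [map_smul, map_one] at h
    simpa [inner_smul_right] using h
  have hherm : ∀ z, (hess f z).IsHermitian := by
    intro z
    have h := (hf.lower z).isHermitian.add
      (Matrix.isHermitian_one.smul (IsSelfAdjoint.all μ) :
        (μ • (1 : Matrix (Fin n) (Fin n) ℝ)).IsHermitian)
    simpa using h
  intro x y z w
  have hs : 0 < Real.sqrt μ := Real.sqrt_pos.2 hμ
  have hw : Real.sqrt μ * ‖y - x‖ ≤ wnorm (hess f z) (y - x) := by
    unfold wnorm
    apply Real.le_sqrt_of_sq_le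
    rw [mul_pow, Real.sq_sqrt hμ.le, real_inner_comm]
    exact key z (y - x)
  have hc : L * ‖y - x‖ ≤ L / (μ * Real.sqrt μ) * wnorm (hess f z) (y - x) * μ := by
    have : L / (μ * Real.sqrt μ) * wnorm (hess f z) (y - x) * μ =
        L / Real.sqrt μ * wnorm (hess f z) (y - x) := by field_simp
    rw [this]
    calc L * ‖y - x‖ = L / Real.sqrt μ * (Real.sqrt μ * ‖y - x‖) := by field_simp
      _ ≤ _ := by gcongr
  set c := L / (μ * Real.sqrt μ) * wnorm (hess f z) (y - x) with hcdef
  have hc0 : 0 ≤ c := by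
    have : 0 ≤ wnorm (hess f z) (y - x) := Real.sqrt_nonneg _
    positivity
  refine Matrix.PosSemidef.of_dotProduct_mulVec_nonneg
    (((hherm w).smul (IsSelfAdjoint.all c)).sub ((hherm y).sub (hherm x))) ?_
  intro v
  have h1 := key w (WithLp.toLp 2 v)
  have h2 : inner ℝ (WithLp.toLp 2 v)
      (Matrix.toEuclideanCLM (𝕜 := ℝ) (hess f y - hess f x) (WithLp.toLp 2 v)) ≤
      L * ‖y - x‖ * ‖WithLp.toLp 2 v‖ ^ 2 := by
    refine (real_inner_le_norm _ _).trans ?_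
    have h3 := ContinuousLinearMap.le_of_opNorm_le _ (hf.lipschitz x y) (WithLp.toLp 2 v)
    nlinarith [norm_nonneg (WithLp.toLp 2 v)]
  have h4 : L * ‖y - x‖ * ‖WithLp.toLp 2 v‖ ^ 2 ≤
      c * inner ℝ (WithLp.toLp 2 v)
        (Matrix.toEuclideanCLM (𝕜 := ℝ) (hess f w) (WithLp.toLp 2 v)) := by
    calc L * ‖y - x‖ * ‖WithLp.toLp 2 v‖ ^ 2 ≤ c * μ * ‖WithLp.toLp 2 v‖ ^ 2 := by gcongr
      _ = c * (μ * ‖WithLp.toLp 2 v‖ ^ 2) := by ring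
      _ ≤ _ := by gcongr
  have h5 := h2.trans h4
  rw [Matrix.inner_toEuclideanCLM, Matrix.inner_toEuclideanCLM] at h5
  simp only [star_trivial, Matrix.sub_mulVec, Matrix.smul_mulVec, dotProduct_sub,
    dotProduct_smul, smul_eq_mul] at h5 ⊢
  linarith

/-- The SR1 update. If `⟨(G - A) u, u⟩ = 0`, then the quotient is zero and `G` is unchanged. -/
def sr1 (G A : Matrix (Fin n) (Fin n) ℝ) (u : Fin n → ℝ) : Matrix (Fin n) (Fin n) ℝ :=
  G - (((G - A) *ᵥ u) ⬝ᵥ u)⁻¹ • ((G - A) * Matrix.vecMulVec u u * (G - A))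

/-- The DFP update. -/
def dfp (G A : Matrix (Fin n) (Fin n) ℝ) (u : Fin n → ℝ) : Matrix (Fin n) (Fin n) ℝ :=
  G - ((A *ᵥ u) ⬝ᵥ u)⁻¹ • (A * Matrix.vecMulVec u u * G + G * Matrix.vecMulVec u u * A)
    + ((((G *ᵥ u) ⬝ᵥ u) / ((A *ᵥ u) ⬝ᵥ u) + 1) / ((A *ᵥ u) ⬝ᵥ u)) •
      (A * Matrix.vecMulVec u u * A)

/-- The member of the Broyden family with parameter `φ`. -/
def broyd (φ : ℝ) (G A : Matrix (Fin n) (Fin n) ℝ) (u : Fin n → ℝ) :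
    Matrix (Fin n) (Fin n) ℝ :=
  φ • dfp G A u + (1 - φ) • sr1 G A u

/-- `e_i` attains the maximum of `⟨G u, u⟩ / ⟨A u, u⟩` over the standard unit vectors `u`. -/
def IsGreedy (G A : Matrix (Fin n) (Fin n) ℝ) (i : Fin n) : Prop :=
  ∀ j, ((G *ᵥ Pi.single j 1) ⬝ᵥ Pi.single j 1) / ((A *ᵥ Pi.single j 1) ⬝ᵥ Pi.single j 1) ≤
    ((G *ᵥ Pi.single i 1) ⬝ᵥ Pi.single i 1) / ((A *ᵥ Pi.single i 1) ⬝ᵥ Pi.single i 1)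

/-- `G'` is a possible value of `gBroyd(G, A)`. Ties in the greedy choice are broken
arbitrarily, and the parameter `φ ∈ [0, 1]` is free at every call. -/
def IsGBroyd (G A G' : Matrix (Fin n) (Fin n) ℝ) : Prop :=
  ∃ φ ∈ Set.Icc (0 : ℝ) 1, ∃ i : Fin n, IsGreedy G A i ∧ G' = broyd φ G A (Pi.single i 1)

/-- `G'` is a possible result of `t` successive updates `gBroyd(·, A)` started at `G`. -/
def IsGBroydIter (A : Matrix (Fin n) (Fin n) ℝ) :
    ℕ → Matrix (Fin n) (Fin n) ℝ → Matrix (Fin n) (Fin n) ℝ → Prop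
  | 0, G, G' => G' = G
  | t + 1, G, G' => ∃ K, IsGBroydIter A t G K ∧ IsGBroyd K A G'

/-- `σ_A(G) = ⟨A⁻¹, G - A⟩`, with the trace inner product. -/
def sigma (A G : Matrix (Fin n) (Fin n) ℝ) : ℝ := (A⁻¹ * (G - A)).trace

/-- `λ(x) = (∇f(x)ᵀ ∇²f(x)⁻¹ ∇f(x)) ^ (1/2)`. -/
def lam (f : EuclideanSpace ℝ (Fin n) → ℝ) (x : EuclideanSpace ℝ (Fin n)) : ℝ :=
  dualNorm (hess f x) (∇ f x)

/-- `ρ = 1 - 1 / (n κ)`. -/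
def rho (n : ℕ) (κ : ℝ) : ℝ := 1 - 1 / (n * κ)

/-- `ε₀ = 1 / (2 κ - 1)`. -/
def epsZero (κ : ℝ) : ℝ := 1 / (2 * κ - 1)

/-- `σ_τ = ρ ^ τ ε + n`. -/
def sigmaTau (n : ℕ) (κ : ℝ) (τ : ℕ) (ε : ℝ) : ℝ := rho n κ ^ τ * ε + n

/-- The constant `c_{τ, ε}`. -/
def cConst (n : ℕ) (κ : ℝ) (τ : ℕ) (ε : ℝ) : ℝ :=
  -(sigmaTau n κ τ ε / (sigmaTau n κ τ ε + n)) +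
    Real.sqrt (rho n κ * sigmaTau n κ τ ε ^ 2 +
        (sigmaTau n κ τ ε + n) * (1 - rho n κ ^ (τ + 1)) * ε) /
      (Real.sqrt (rho n κ) * (sigmaTau n κ τ ε + n))

/-- `β(x) = L ‖∇f(x)‖ / (2 μ²)`. -/
def beta (f : EuclideanSpace ℝ (Fin n) → ℝ) (μ L : ℝ) (x : EuclideanSpace ℝ (Fin n)) : ℝ :=
  L * ‖∇ f x‖ / (2 * μ ^ 2)

/-- The adaptive stepsize `min {c_{τ, ε₀} / (M ‖∇f(x)‖_G^*), 1 / (4 β(x)), 1}`.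
If `∇f(x) = 0`, then the two quotients are not meaningful, but then the step
`α G⁻¹ ∇f(x)` is zero whatever `α` is. -/
def stepsize (f : EuclideanSpace ℝ (Fin n) → ℝ) (μ ω L M : ℝ) (τ : ℕ)
    (x : EuclideanSpace ℝ (Fin n)) (G : Matrix (Fin n) (Fin n) ℝ) : ℝ :=
  min (min (cConst n (ω / μ) τ (epsZero (ω / μ)) / (M * dualNorm G (∇ f x)))
    (1 / (4 * beta f μ L x))) 1

/-- `(x^k, G^k)` is a sequence of iterates of the AGQN method. -/
structure IsRun (f : EuclideanSpace ℝ (Fin n) → ℝ) (μ ω L M : ℝ) (τ : ℕ)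
    (x : ℕ → EuclideanSpace ℝ (Fin n)) (G : ℕ → Matrix (Fin n) (Fin n) ℝ) : Prop where
  step_x : ∀ k, x (k + 1) = x k -
    stepsize f μ ω L M τ (x k) (G k) • Matrix.toEuclideanCLM (𝕜 := ℝ) (G k)⁻¹ (∇ f (x k))
  step_G : ∀ k, ∃ K, IsGBroydIter (hess f (x k)) τ (G k) K ∧
    IsGBroyd ((1 + M * wnorm (hess f (x k)) (x (k + 1) - x k)) • K) (hess f (x (k + 1)))
      (G (k + 1))

end AGQN

end

noncomputable section

namespace AGQN

open Matrix

variable {n : ℕ}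

/-! ### Quadratic forms and the Loewner order -/

/-! Write `A = ∇²f(x^k)`, `G = G^k`, `σ = σ_A(G)` and `l = Mλ(x^k)`. If `A ⪯ G ⪯ (1 + σ)A` and the
full step is taken, the new gradient is the residual `(I - AG⁻¹)∇f(x^k)` plus a Taylor remainder. In
the dual norm of `A` the residual shrinks by `σ/(1+σ)`, self-concordance bounds the remainder by
`lλ/2`, and passing to the new Hessian costs `√(1+l)`. Hence `λ⁺ ≤ √(1+l) (σ/(1+σ) + l/2) λ`
(`lam_step_le`).

Every greedy Broyden update preserves `A ⪯ G` and multiplies `σ` by at most `ρ`, while changing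
Hessian and rescaling inflates `σ + n` by at most `(1+l)²`. So `σ⁺ ≤ ρ((1+l)²(ρ^τ σ + n) - n)`
(`IsRun.loewner_sigma_succ`). The constant `c` is such that `l ≤ c` and `σ ≤ ε₀` force `σ⁺ ≤ ε₀`
(`cConst_spec`). Since `‖∇f(x^k)‖` never exceeds its initial value, neither cap on the stepsize is
ever active and all steps are full (`IsRun.invariant`).

What remains concerns two real sequences. With `σ ≤ 1` and `l ≤ 1/4` the factor of `λ` is at most
`3/4`, which is the first claim. For the second, the potential `σ + 4nl` is multiplied at each step
by at most `max{ρ^(τ+1), 3ρ/4} (1 + (12n+2)l)`; as `l` decays geometrically, the accumulated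
corrections cost at most a factor 2 (`superlinear_factor_le`). -/

theorem dotProduct_mulVec_comm_of_isHermitian {A : Matrix (Fin n) (Fin n) ℝ} (hA : A.IsHermitian)
    (v w : Fin n → ℝ) : v ⬝ᵥ A *ᵥ w = w ⬝ᵥ A *ᵥ v := by
  have h : Aᵀ = A := by simpa [IsHermitian, conjTranspose_eq_transpose_of_trivial] using hA
  rw [dotProduct_mulVec, ← mulVec_transpose, h, dotProduct_comm]

theorem Loewner.dot_le {A B : Matrix (Fin n) (Fin n) ℝ} (h : Loewner A B) (v : Fin n → ℝ) :
    v ⬝ᵥ A *ᵥ v ≤ v ⬝ᵥ B *ᵥ v := by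
  have h1 := PosSemidef.dotProduct_mulVec_nonneg h v
  simpa [sub_mulVec, dotProduct_sub] using h1

theorem loewner_of_dot_le {A B : Matrix (Fin n) (Fin n) ℝ} (hA : A.IsHermitian)
    (hB : B.IsHermitian) (h : ∀ v : Fin n → ℝ, v ⬝ᵥ A *ᵥ v ≤ v ⬝ᵥ B *ᵥ v) : Loewner A B :=
  PosSemidef.of_dotProduct_mulVec_nonneg (hB.sub hA) fun v => by
    simpa [sub_mulVec, dotProduct_sub] using h v

theorem Loewner.trans {A B C : Matrix (Fin n) (Fin n) ℝ} (h₁ : Loewner A B) (h₂ : Loewner B C) :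
    Loewner A C := by
  have h := PosSemidef.add h₁ h₂
  unfold Loewner
  convert h using 1
  abel

theorem Loewner.posDef {A B : Matrix (Fin n) (Fin n) ℝ} (h : Loewner A B) (hA : A.PosDef) :
    B.PosDef := by
  have h' := hA.add_posSemidef h
  rwa [add_sub_cancel] at h'

theorem isHermitian_smul {A : Matrix (Fin n) (Fin n) ℝ} (hA : A.IsHermitian) (c : ℝ) :
    (c • A).IsHermitian := hA.smul (IsSelfAdjoint.all c)

/-- A symmetric form bounded by `c P` on the diagonal satisfies the Cauchy-Schwarz inequality
with respect to `c P`. -/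
theorem sq_dotProduct_mulVec_le {D P : Matrix (Fin n) (Fin n) ℝ} (hD : D.IsHermitian)
    (hP : P.IsHermitian) {c : ℝ} (h₁ : ∀ v : Fin n → ℝ, v ⬝ᵥ D *ᵥ v ≤ c * (v ⬝ᵥ P *ᵥ v))
    (h₂ : ∀ v : Fin n → ℝ, -(c * (v ⬝ᵥ P *ᵥ v)) ≤ v ⬝ᵥ D *ᵥ v) (v w : Fin n → ℝ) :
    (v ⬝ᵥ D *ᵥ w) ^ 2 ≤ c ^ 2 * (v ⬝ᵥ P *ᵥ v) * (w ⬝ᵥ P *ᵥ w) := by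
  have key : ∀ t : ℝ, 0 ≤ c * (v ⬝ᵥ P *ᵥ v) * (t * t) + (-2 * (v ⬝ᵥ D *ᵥ w)) * t +
      c * (w ⬝ᵥ P *ᵥ w) := by
    intro t
    -- Polarisation: subtracting the lower bound at `tv - w` from the upper bound at `tv + w`
    -- cancels the diagonal terms of `D` and the cross terms of `P`.
    have e₁ := h₁ (t • v + w)
    have e₂ := h₂ (t • v - w)
    simp only [mulVec_add, mulVec_sub, mulVec_smul, add_dotProduct, dotProduct_add,
      sub_dotProduct, dotProduct_sub, smul_dotProduct, dotProduct_smul, smul_eq_mul] at e₁ e₂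
    rw [dotProduct_mulVec_comm_of_isHermitian hD w v,
      dotProduct_mulVec_comm_of_isHermitian hP w v] at e₁ e₂
    nlinarith
  have h := discrim_le_zero key
  unfold discrim at h
  nlinarith

theorem PosSemidef.sq_dotProduct_mulVec_le {P : Matrix (Fin n) (Fin n) ℝ} (hP : P.PosSemidef)
    (v w : Fin n → ℝ) : (v ⬝ᵥ P *ᵥ w) ^ 2 ≤ (v ⬝ᵥ P *ᵥ v) * (w ⬝ᵥ P *ᵥ w) := by
  have h0 : ∀ v : Fin n → ℝ, 0 ≤ v ⬝ᵥ P *ᵥ v := fun v => by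
    simpa using hP.dotProduct_mulVec_nonneg v
  have h := AGQN.sq_dotProduct_mulVec_le hP.isHermitian hP.isHermitian (c := 1)
    (fun v => by simp) (fun v => by linarith [h0 v]) v w
  simpa using h

theorem PosSemidef.dot_nonneg {P : Matrix (Fin n) (Fin n) ℝ} (hP : P.PosSemidef)
    (v : Fin n → ℝ) : 0 ≤ v ⬝ᵥ P *ᵥ v := by
  simpa using hP.dotProduct_mulVec_nonneg v

theorem PosDef.dot_pos {P : Matrix (Fin n) (Fin n) ℝ} (hP : P.PosDef)
    {v : Fin n → ℝ} (hv : v ≠ 0) : 0 < v ⬝ᵥ P *ᵥ v := by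
  simpa using hP.dotProduct_mulVec_pos hv

theorem PosDef.inv_mul {A : Matrix (Fin n) (Fin n) ℝ} (hA : A.PosDef) : A⁻¹ * A = 1 :=
  nonsing_inv_mul A ((isUnit_iff_isUnit_det A).1 hA.isUnit)

theorem PosDef.mul_inv {A : Matrix (Fin n) (Fin n) ℝ} (hA : A.PosDef) : A * A⁻¹ = 1 :=
  mul_nonsing_inv A ((isUnit_iff_isUnit_det A).1 hA.isUnit)

theorem PosDef.inv_mulVec_mulVec {A : Matrix (Fin n) (Fin n) ℝ} (hA : A.PosDef)
    (v : Fin n → ℝ) : A⁻¹ *ᵥ (A *ᵥ v) = v := by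
  rw [mulVec_mulVec, PosDef.inv_mul hA, one_mulVec]

theorem PosDef.mulVec_inv_mulVec {A : Matrix (Fin n) (Fin n) ℝ} (hA : A.PosDef)
    (v : Fin n → ℝ) : A *ᵥ (A⁻¹ *ᵥ v) = v := by
  rw [mulVec_mulVec, PosDef.mul_inv hA, one_mulVec]

theorem PosDef.dot_mulVec_inv {A : Matrix (Fin n) (Fin n) ℝ} (hA : A.PosDef)
    (v w : Fin n → ℝ) : (A⁻¹ *ᵥ v) ⬝ᵥ A *ᵥ w = v ⬝ᵥ w := by
  rw [dotProduct_mulVec_comm_of_isHermitian hA.isHermitian, PosDef.mulVec_inv_mulVec hA,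
    dotProduct_comm]

/-- Cauchy-Schwarz in the inner product of `A`, for the vectors `A⁻¹y` and `v`. With the converse
`PosDef.dot_inv_le` it characterises the dual norm, so that antitonicity of the inverse follows by
duality. -/
theorem PosDef.sq_dot_le {A : Matrix (Fin n) (Fin n) ℝ} (hA : A.PosDef) (y v : Fin n → ℝ) :
    (y ⬝ᵥ v) ^ 2 ≤ (y ⬝ᵥ A⁻¹ *ᵥ y) * (v ⬝ᵥ A *ᵥ v) := by
  have h := PosSemidef.sq_dotProduct_mulVec_le hA.posSemidef (A⁻¹ *ᵥ y) v
  rw [PosDef.dot_mulVec_inv hA, PosDef.dot_mulVec_inv hA] at h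
  exact h

theorem PosDef.dot_inv_le {A : Matrix (Fin n) (Fin n) ℝ} (hA : A.PosDef) {y : Fin n → ℝ} {C : ℝ}
    (hC : 0 ≤ C) (h : ∀ v : Fin n → ℝ, (y ⬝ᵥ v) ^ 2 ≤ C * (v ⬝ᵥ A *ᵥ v)) :
    y ⬝ᵥ A⁻¹ *ᵥ y ≤ C := by
  have h1 := h (A⁻¹ *ᵥ y)
  rw [PosDef.dot_mulVec_inv hA] at h1
  have h2 := PosSemidef.dot_nonneg hA.inv.posSemidef y
  by_contra! h3
  nlinarith

theorem Loewner.inv {A B : Matrix (Fin n) (Fin n) ℝ} (h : Loewner A B) (hA : A.PosDef) :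
    Loewner B⁻¹ A⁻¹ := by
  have hB := h.posDef hA
  refine loewner_of_dot_le hB.inv.isHermitian hA.inv.isHermitian fun v =>
    PosDef.dot_inv_le hB (PosSemidef.dot_nonneg hA.inv.posSemidef v) fun w => ?_
  refine (PosDef.sq_dot_le hA v w).trans ?_
  exact mul_le_mul_of_nonneg_left (h.dot_le w) (PosSemidef.dot_nonneg hA.inv.posSemidef v)

theorem loewner_smul {A B : Matrix (Fin n) (Fin n) ℝ} (h : Loewner A B) {c : ℝ} (hc : 0 ≤ c) :
    Loewner (c • A) (c • B) := by
  unfold Loewner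
  rw [← smul_sub]
  exact PosSemidef.smul h hc

theorem trace_vecMulVec_mul (v w : Fin n → ℝ) (B : Matrix (Fin n) (Fin n) ℝ) :
    (vecMulVec v w * B).trace = w ⬝ᵥ B *ᵥ v := by
  rw [vecMulVec_mul, trace_vecMulVec, dotProduct_comm, dotProduct_mulVec]

theorem trace_mul_nonneg {A B : Matrix (Fin n) (Fin n) ℝ} (hA : A.PosSemidef)
    (hB : B.PosSemidef) : 0 ≤ (A * B).trace := by
  obtain ⟨m, v, rfl⟩ := posSemidef_iff_eq_sum_vecMulVec.1 hA
  rw [Finset.sum_mul, trace_sum]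
  refine Finset.sum_nonneg fun i _ => ?_
  rw [trace_vecMulVec_mul]
  simpa using PosSemidef.dot_nonneg hB (v i)

theorem trace_mul_le_of_loewner {A B K : Matrix (Fin n) (Fin n) ℝ} (h : Loewner A B)
    (hK : K.PosSemidef) : (A * K).trace ≤ (B * K).trace := by
  have := trace_mul_nonneg h hK
  rw [sub_mul, trace_sub] at this
  linarith

/-! ### The Broyden family -/

theorem dot_mul_vecMulVec_mul {A B : Matrix (Fin n) (Fin n) ℝ} (hB : B.IsHermitian)
    (u v : Fin n → ℝ) :
    v ⬝ᵥ (A * vecMulVec u u * B) *ᵥ v = (v ⬝ᵥ A *ᵥ u) * (v ⬝ᵥ B *ᵥ u) := by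
  rw [← mulVec_mulVec, ← mulVec_mulVec, vecMulVec_mulVec]
  simp [mulVec_smul, dotProduct_mulVec_comm_of_isHermitian hB u v, mul_comm]

theorem trace_inv_mul_vecMulVec {A B C : Matrix (Fin n) (Fin n) ℝ} (u : Fin n → ℝ) :
    (A⁻¹ * (B * vecMulVec u u * C)).trace = u ⬝ᵥ C *ᵥ (A⁻¹ *ᵥ (B *ᵥ u)) := by
  have : (A⁻¹ * (B * vecMulVec u u * C)).trace = (vecMulVec u u * (C * A⁻¹ * B)).trace := by
    rw [← Matrix.mul_assoc, trace_mul_comm, trace_mul_comm (vecMulVec u u)]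
    rw [← Matrix.mul_assoc, ← Matrix.mul_assoc]
  rw [this, trace_vecMulVec_mul, mulVec_mulVec, mulVec_mulVec, Matrix.mul_assoc]

theorem isHermitian_mul_vecMulVec_mul {A : Matrix (Fin n) (Fin n) ℝ} (hA : A.IsHermitian)
    (u : Fin n → ℝ) : (A * vecMulVec u u * A).IsHermitian := by
  have hA' : Aᵀ = A := by simpa [IsHermitian, conjTranspose_eq_transpose_of_trivial] using hA
  simp [IsHermitian, conjTranspose_eq_transpose_of_trivial, transpose_mul, hA',
    transpose_vecMulVec, Matrix.mul_assoc]

theorem dfp_isHermitian {G A : Matrix (Fin n) (Fin n) ℝ} (hG : G.IsHermitian)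
    (hA : A.IsHermitian) (u : Fin n → ℝ) : (dfp G A u).IsHermitian := by
  have hA' : Aᵀ = A := by simpa [IsHermitian, conjTranspose_eq_transpose_of_trivial] using hA
  have hG' : Gᵀ = G := by simpa [IsHermitian, conjTranspose_eq_transpose_of_trivial] using hG
  refine (hG.sub (isHermitian_smul ?_ _)).add
    (isHermitian_smul (isHermitian_mul_vecMulVec_mul hA u) _)
  simp [IsHermitian, conjTranspose_eq_transpose_of_trivial, transpose_mul, hA', hG',
    transpose_vecMulVec, Matrix.mul_assoc, add_comm]

/-- The form of `DFP - A` at `v` is the form of `G - A` at the `A`-orthogonal projection of `v` off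
`u`. -/
theorem loewner_dfp {G A : Matrix (Fin n) (Fin n) ℝ} (hA : A.PosDef) (h : Loewner A G)
    {u : Fin n → ℝ} (hu : u ≠ 0) : Loewner A (dfp G A u) := by
  have hG := (h.posDef hA).isHermitian
  refine loewner_of_dot_le hA.isHermitian (dfp_isHermitian hG hA.isHermitian u) fun v => ?_
  have ha := PosDef.dot_pos hA hu
  have h1 := h.dot_le (v - ((v ⬝ᵥ A *ᵥ u) / (u ⬝ᵥ A *ᵥ u)) • u)
  simp only [dfp, add_mulVec, sub_mulVec, smul_mulVec, dotProduct_add, dotProduct_sub,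
    dotProduct_smul, dot_mul_vecMulVec_mul hG, dot_mul_vecMulVec_mul hA.isHermitian, smul_eq_mul,
    mulVec_sub, mulVec_smul, sub_dotProduct, smul_dotProduct, dotProduct_comm (A *ᵥ u),
    dotProduct_comm (G *ᵥ u)] at h1 ⊢
  rw [dotProduct_mulVec_comm_of_isHermitian hA.isHermitian u v,
    dotProduct_mulVec_comm_of_isHermitian hG u v] at h1
  set a := u ⬝ᵥ A *ᵥ u
  set b := v ⬝ᵥ A *ᵥ u
  set g := u ⬝ᵥ G *ᵥ u
  set p := v ⬝ᵥ G *ᵥ u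
  set x := v ⬝ᵥ A *ᵥ v
  set y := v ⬝ᵥ G *ᵥ v
  have e1 : x - b / a * b - b / a * (b - b / a * a) = x - b ^ 2 / a := by
    field_simp
    ring
  have e2 : y - b / a * p - b / a * (p - b / a * g) = y - 2 * b * p / a + b ^ 2 * g / a ^ 2 := by
    field_simp
    ring
  have e3 : y - a⁻¹ * (b * p + p * b) + (g / a + 1) / a * (b * b) =
      y - 2 * b * p / a + b ^ 2 * g / a ^ 2 + b ^ 2 / a := by
    field_simp
    ring
  rw [e3]
  linarith

theorem sr1_isHermitian {G A : Matrix (Fin n) (Fin n) ℝ} (hG : G.IsHermitian)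
    (hA : A.IsHermitian) (u : Fin n → ℝ) : (sr1 G A u).IsHermitian :=
  hG.sub (isHermitian_smul (isHermitian_mul_vecMulVec_mul (hG.sub hA) u) _)

/-- The rank-one correction of `G - A` is dominated by `G - A` itself, by Cauchy-Schwarz for that
semidefinite form. -/
theorem loewner_sr1 {G A : Matrix (Fin n) (Fin n) ℝ} (hA : A.PosDef) (h : Loewner A G)
    (u : Fin n → ℝ) : Loewner A (sr1 G A u) := by
  have hG := (h.posDef hA).isHermitian
  refine loewner_of_dot_le hA.isHermitian (sr1_isHermitian hG hA.isHermitian u) fun v => ?_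
  have h1 := PosSemidef.sq_dotProduct_mulVec_le h v u
  have h2 := PosSemidef.dot_nonneg h u
  have h3 := PosSemidef.dot_nonneg h v
  have h4 : v ⬝ᵥ (G - A) *ᵥ v = v ⬝ᵥ G *ᵥ v - v ⬝ᵥ A *ᵥ v := by
    rw [sub_mulVec, dotProduct_sub]
  rw [sr1, sub_mulVec, smul_mulVec, dotProduct_sub, dotProduct_smul,
    dot_mul_vecMulVec_mul (hG.sub hA.isHermitian), smul_eq_mul, dotProduct_comm ((G - A) *ᵥ u)]
  have h5 : (u ⬝ᵥ (G - A) *ᵥ u)⁻¹ * (v ⬝ᵥ (G - A) *ᵥ u * v ⬝ᵥ (G - A) *ᵥ u) ≤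
      v ⬝ᵥ (G - A) *ᵥ v := by
    rcases h2.eq_or_lt with h0 | h0
    · rw [← h0]
      simpa using h3
    · rw [inv_mul_le_iff₀ h0]
      nlinarith
  linarith

theorem loewner_broyd {G A : Matrix (Fin n) (Fin n) ℝ} (hA : A.PosDef) (h : Loewner A G)
    {u : Fin n → ℝ} (hu : u ≠ 0) {φ : ℝ} (hφ : φ ∈ Set.Icc (0 : ℝ) 1) :
    Loewner A (broyd φ G A u) := by
  have h1 := PosSemidef.add (PosSemidef.smul (loewner_dfp hA h hu) hφ.1)
    (PosSemidef.smul (loewner_sr1 hA h u) (sub_nonneg.2 hφ.2))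
  unfold Loewner broyd
  convert h1 using 1
  module

theorem sigma_nonneg {G A : Matrix (Fin n) (Fin n) ℝ} (hA : A.PosDef) (h : Loewner A G) :
    0 ≤ sigma A G := trace_mul_nonneg hA.inv.posSemidef h

theorem sigma_dfp (G : Matrix (Fin n) (Fin n) ℝ) {A : Matrix (Fin n) (Fin n) ℝ} (hA : A.PosDef)
    {u : Fin n → ℝ} (hu : u ≠ 0) :
    sigma A (dfp G A u) = sigma A G - (u ⬝ᵥ (G - A) *ᵥ u) / (u ⬝ᵥ A *ᵥ u) := by
  have ha := PosDef.dot_pos hA hu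
  have e1 : u ⬝ᵥ A *ᵥ (A⁻¹ *ᵥ (G *ᵥ u)) = u ⬝ᵥ G *ᵥ u := by
    rw [PosDef.mulVec_inv_mulVec hA]
  have e2 : u ⬝ᵥ G *ᵥ (A⁻¹ *ᵥ (A *ᵥ u)) = u ⬝ᵥ G *ᵥ u := by
    rw [PosDef.inv_mulVec_mulVec hA]
  have e3 : u ⬝ᵥ A *ᵥ (A⁻¹ *ᵥ (A *ᵥ u)) = u ⬝ᵥ A *ᵥ u := by
    rw [PosDef.inv_mulVec_mulVec hA]
  simp only [sigma, dfp, mul_sub, mul_add, trace_sub, trace_add, mul_smul_comm, trace_smul,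
    trace_inv_mul_vecMulVec, e1, e2, e3, smul_eq_mul, sub_mulVec, dotProduct_sub,
    dotProduct_comm (A *ᵥ u), dotProduct_comm (G *ᵥ u)]
  field_simp
  ring

/-- SR1 lowers `σ` by `⟨A⁻¹Du, Du⟩/⟨Du, u⟩` with `D = G - A`; by dual Cauchy-Schwarz this is at
least the decrease made by DFP. -/
theorem sigma_sr1_le {G A : Matrix (Fin n) (Fin n) ℝ} (hA : A.PosDef) (h : Loewner A G)
    {u : Fin n → ℝ} (hu : u ≠ 0) :
    sigma A (sr1 G A u) ≤ sigma A G - (u ⬝ᵥ (G - A) *ᵥ u) / (u ⬝ᵥ A *ᵥ u) := by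
  have ha := PosDef.dot_pos hA hu
  have h2 := PosSemidef.dot_nonneg h u
  have h1 := PosDef.sq_dot_le hA ((G - A) *ᵥ u) u
  rw [dotProduct_comm, dotProduct_comm ((G - A) *ᵥ u)] at h1
  have e : u ⬝ᵥ (G - A) *ᵥ (A⁻¹ *ᵥ ((G - A) *ᵥ u)) =
      (A⁻¹ *ᵥ ((G - A) *ᵥ u)) ⬝ᵥ ((G - A) *ᵥ u) :=
    dotProduct_mulVec_comm_of_isHermitian h.isHermitian _ _
  have e2 : sigma A (sr1 G A u) = sigma A G -
      (u ⬝ᵥ (G - A) *ᵥ u)⁻¹ * ((A⁻¹ *ᵥ ((G - A) *ᵥ u)) ⬝ᵥ ((G - A) *ᵥ u)) := by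
    rw [sigma, sr1, sub_right_comm, mul_sub, trace_sub, mul_smul_comm, trace_smul,
      trace_inv_mul_vecMulVec, e, dotProduct_comm ((G - A) *ᵥ u) u, smul_eq_mul, sigma]
  rw [e2]
  rcases h2.eq_or_lt with h0 | h0
  · rw [← h0]
    simp
  · have : (u ⬝ᵥ (G - A) *ᵥ u) / (u ⬝ᵥ A *ᵥ u) ≤
        (u ⬝ᵥ (G - A) *ᵥ u)⁻¹ * ((A⁻¹ *ᵥ ((G - A) *ᵥ u)) ⬝ᵥ ((G - A) *ᵥ u)) := by
      rw [div_le_iff₀ ha, mul_assoc, ← div_eq_inv_mul, le_div_iff₀ h0]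
      nlinarith
    linarith

theorem sigma_broyd_le {G A : Matrix (Fin n) (Fin n) ℝ} (hA : A.PosDef) (h : Loewner A G)
    {u : Fin n → ℝ} (hu : u ≠ 0) {φ : ℝ} (hφ : φ ∈ Set.Icc (0 : ℝ) 1) :
    sigma A (broyd φ G A u) ≤ sigma A G - (u ⬝ᵥ (G - A) *ᵥ u) / (u ⬝ᵥ A *ᵥ u) := by
  have e : sigma A (broyd φ G A u) =
      φ * sigma A (dfp G A u) + (1 - φ) * sigma A (sr1 G A u) := by
    simp only [sigma, broyd, mul_sub, mul_add, mul_smul_comm, trace_sub, trace_add, trace_smul,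
      smul_eq_mul]
    ring
  rw [e, sigma_dfp G hA hu]
  have := sigma_sr1_le hA h hu
  nlinarith [hφ.2]

theorem dot_le_sigma_mul {G A : Matrix (Fin n) (Fin n) ℝ} (hA : A.PosDef) (h : Loewner A G)
    (v : Fin n → ℝ) : v ⬝ᵥ G *ᵥ v ≤ (1 + sigma A G) * (v ⬝ᵥ A *ᵥ v) := by
  rcases eq_or_ne v 0 with rfl | hv
  · simp
  have ha := PosDef.dot_pos hA hv
  -- A DFP update along `v` itself leaves `σ` nonnegative, so `σ` is at least the decrease `⟨(G-A)v,
  -- v⟩/⟨Av, v⟩`. No eigenvalues are needed.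
  have h1 := sigma_nonneg hA (loewner_dfp hA h hv)
  rw [sigma_dfp G hA hv, sub_nonneg, div_le_iff₀ ha, sub_mulVec,
    dotProduct_sub] at h1
  linarith

theorem loewner_smul_of_sigma {G A : Matrix (Fin n) (Fin n) ℝ} (hA : A.PosDef)
    (h : Loewner A G) : Loewner G ((1 + sigma A G) • A) :=
  loewner_of_dot_le (h.posDef hA).isHermitian (isHermitian_smul hA.isHermitian _) fun v => by
    simpa [smul_mulVec] using dot_le_sigma_mul hA h v

/-! ### Greedy updates -/

theorem IsGBroyd.loewner {G A K : Matrix (Fin n) (Fin n) ℝ} (hA : A.PosDef) (h : Loewner A G)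
    (hK : IsGBroyd G A K) : Loewner A K := by
  obtain ⟨φ, hφ, i, -, rfl⟩ := hK
  exact loewner_broyd hA h (by simp) hφ

/-- Each diagonal entry of `G - A` is its ratio to `A j j ≤ ω` times `A j j`, and the greedy index
maximises the ratio. -/
theorem trace_le_of_isGreedy {G A : Matrix (Fin n) (Fin n) ℝ} {ω : ℝ} (hA : A.PosDef)
    (hω : Loewner A (ω • 1)) (h : Loewner A G) {i : Fin n} (hi : IsGreedy G A i) :
    (G - A).trace ≤ n * ω * ((Pi.single i 1 ⬝ᵥ (G - A) *ᵥ Pi.single i 1) /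
      (Pi.single i 1 ⬝ᵥ A *ᵥ Pi.single i 1)) := by
  have hpos : ∀ j : Fin n, 0 < (Pi.single j 1 : Fin n → ℝ) ⬝ᵥ A *ᵥ Pi.single j 1 := fun j =>
    PosDef.dot_pos hA (by simp)
  have hle : ∀ j : Fin n, (Pi.single j 1 : Fin n → ℝ) ⬝ᵥ A *ᵥ Pi.single j 1 ≤ ω := fun j => by
    have := hω.dot_le (Pi.single j 1)
    simpa [smul_mulVec] using this
  set r := ((Pi.single i 1 ⬝ᵥ (G - A) *ᵥ Pi.single i 1) /
      (Pi.single i 1 ⬝ᵥ A *ᵥ Pi.single i 1)) with hr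
  have hr0 : 0 ≤ r := div_nonneg (PosSemidef.dot_nonneg h _) (hpos i).le
  have hj : ∀ j : Fin n, (G - A) j j ≤ ω * r := by
    intro j
    have h1 := hi j
    rw [dotProduct_comm, dotProduct_comm (A *ᵥ _), dotProduct_comm (G *ᵥ _),
      dotProduct_comm (A *ᵥ _)] at h1
    have h2 : ((Pi.single j 1 : Fin n → ℝ) ⬝ᵥ (G - A) *ᵥ Pi.single j 1) /
      (Pi.single j 1 ⬝ᵥ A *ᵥ Pi.single j 1) ≤ r := by
      rw [hr, sub_mulVec, sub_mulVec, dotProduct_sub, dotProduct_sub, sub_div, sub_div,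
        div_self (hpos j).ne', div_self (hpos i).ne']
      linarith
    rw [div_le_iff₀ (hpos j)] at h2
    have h3 : (G - A) j j = (Pi.single j 1 : Fin n → ℝ) ⬝ᵥ (G - A) *ᵥ Pi.single j 1 := by
      simp
    rw [h3]
    nlinarith [hle j]
  calc (G - A).trace = ∑ j, (G - A) j j := rfl
    _ ≤ ∑ _j : Fin n, ω * r := Finset.sum_le_sum fun j _ => hj j
    _ = n * ω * r := by simp [mul_assoc]

theorem inv_loewner_of_smul_one {A : Matrix (Fin n) (Fin n) ℝ} {μ : ℝ} (hμ : 0 < μ)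
    (h : Loewner (μ • 1) A) : Loewner A⁻¹ (μ⁻¹ • 1) := by
  have h1 := h.inv (PosDef.one.smul hμ)
  have e : (μ • (1 : Matrix (Fin n) (Fin n) ℝ))⁻¹ = μ⁻¹ • 1 := by
    refine inv_eq_left_inv ?_
    simp [smul_smul, hμ.ne']
  rwa [e] at h1

theorem sigma_le_trace {G A : Matrix (Fin n) (Fin n) ℝ} {μ : ℝ} (hμ : 0 < μ)
    (hμA : Loewner (μ • 1) A) (h : Loewner A G) : sigma A G ≤ μ⁻¹ * (G - A).trace := by
  have h1 := trace_mul_le_of_loewner (inv_loewner_of_smul_one hμ hμA) h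
  rwa [smul_mul_assoc, one_mul, trace_smul, smul_eq_mul] at h1

theorem IsGBroyd.sigma_le {G A K : Matrix (Fin n) (Fin n) ℝ} {μ ω : ℝ} (hμ : 0 < μ) (hω : 0 < ω)
    (hμA : Loewner (μ • 1) A) (hωA : Loewner A (ω • 1)) (h : Loewner A G)
    (hK : IsGBroyd G A K) : sigma A K ≤ rho n (ω / μ) * sigma A G := by
  have hA : A.PosDef := hμA.posDef (PosDef.one.smul hμ)
  obtain ⟨φ, hφ, i, hi, rfl⟩ := hK
  have h1 := sigma_broyd_le hA h (u := Pi.single i 1) (by simp) hφ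
  have h2 := trace_le_of_isGreedy hA hωA h hi
  have h3 := sigma_le_trace hμ hμA h
  set r := ((Pi.single i 1 ⬝ᵥ (G - A) *ᵥ Pi.single i 1) /
      (Pi.single i 1 ⬝ᵥ A *ᵥ Pi.single i 1))
  have hn : (0 : ℝ) < n := by exact_mod_cast i.pos
  -- The decrease of `σ` along the greedy direction is at least the fraction `1/(nκ)` of `σ`.
  have h4 : sigma A G / (n * (ω / μ)) ≤ r := by
    rw [div_le_iff₀ (by positivity)]
    calc sigma A G ≤ μ⁻¹ * (n * ω * r) := h3.trans (by gcongr)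
      _ = _ := by field_simp
  unfold rho
  have : (1 - 1 / (n * (ω / μ))) * sigma A G = sigma A G - sigma A G / (n * (ω / μ)) := by ring
  rw [this]
  linarith

theorem IsGBroydIter.loewner {A : Matrix (Fin n) (Fin n) ℝ} (hA : A.PosDef) {t : ℕ} :
    ∀ {G K : Matrix (Fin n) (Fin n) ℝ}, Loewner A G → IsGBroydIter A t G K → Loewner A K := by
  induction t with
  | zero => rintro G K h rfl; exact h
  | succ t ih => rintro G K h ⟨K', h1, h2⟩; exact h2.loewner hA (ih h h1)

theorem IsGBroydIter.sigma_le {A : Matrix (Fin n) (Fin n) ℝ} {μ ω : ℝ} (hμ : 0 < μ) (hω : 0 < ω)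
    (hρ : 0 ≤ rho n (ω / μ)) (hμA : Loewner (μ • 1) A) (hωA : Loewner A (ω • 1)) {t : ℕ} :
    ∀ {G K : Matrix (Fin n) (Fin n) ℝ}, Loewner A G → IsGBroydIter A t G K →
      sigma A K ≤ rho n (ω / μ) ^ t * sigma A G := by
  have hA : A.PosDef := hμA.posDef (PosDef.one.smul hμ)
  induction t with
  | zero => rintro G K h rfl; simp
  | succ t ih =>
    rintro G K h ⟨K', h1, h2⟩
    refine (h2.sigma_le hμ hω hμA hωA (h1.loewner hA h)).trans ?_
    rw [pow_succ', mul_assoc]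
    exact mul_le_mul_of_nonneg_left (ih h h1) hρ

theorem sigma_eq {A : Matrix (Fin n) (Fin n) ℝ} (hA : A.PosDef) (G : Matrix (Fin n) (Fin n) ℝ) :
    sigma A G = (A⁻¹ * G).trace - n := by
  rw [sigma, mul_sub, PosDef.inv_mul hA, trace_sub, trace_one, Fintype.card_fin]

theorem Loewner.inv_loewner_smul_inv {A A' : Matrix (Fin n) (Fin n) ℝ} {m : ℝ}
    (h : Loewner A ((1 + m) • A')) (hA : A.PosDef) (hA' : A'.PosDef) (hm : 0 ≤ m) :
    Loewner A'⁻¹ ((1 + m) • A⁻¹) := by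
  have h1 := loewner_smul (h.inv hA) (show (0 : ℝ) ≤ 1 + m by linarith)
  have hm' : (1 + m) ≠ 0 := by linarith
  have : ((1 + m) • A')⁻¹ = (1 + m)⁻¹ • A'⁻¹ := by
    refine inv_eq_left_inv ?_
    simp [smul_smul, hm', PosDef.inv_mul hA']
  rwa [this, smul_smul, mul_inv_cancel₀ hm', one_smul] at h1

/-- Passing from `A` to `A'` with `A ⪯ (1 + m) A'` and rescaling by `1 + m`. -/
theorem sigma_smul_le {A A' K : Matrix (Fin n) (Fin n) ℝ} (hA : A.PosDef) (hA' : A'.PosDef)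
    (hK : Loewner A K) {m : ℝ} (hm : 0 ≤ m) (h : Loewner A ((1 + m) • A')) :
    sigma A' ((1 + m) • K) ≤ (1 + m) ^ 2 * (sigma A K + n) - n := by
  -- One factor `1 + m` comes from replacing `A⁻¹` by `A'⁻¹` in the trace, the other from rescaling
  -- `K`.
  have h1 := h.inv_loewner_smul_inv hA hA' hm
  have h2 := trace_mul_le_of_loewner h1 (hK.posDef hA).posSemidef
  rw [sigma_eq hA', sigma_eq hA, mul_smul_comm, trace_smul]
  simp only [smul_mul_assoc, trace_smul, smul_eq_mul] at h2 ⊢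
  nlinarith

/-! ### Weighted norms -/

theorem wnorm_eq (A : Matrix (Fin n) (Fin n) ℝ) (h : EuclideanSpace ℝ (Fin n)) :
    wnorm A h = Real.sqrt (h.ofLp ⬝ᵥ A *ᵥ h.ofLp) := by
  rw [wnorm, real_inner_comm, inner_toEuclideanCLM]

theorem wnorm_nonneg (A : Matrix (Fin n) (Fin n) ℝ) (h : EuclideanSpace ℝ (Fin n)) :
    0 ≤ wnorm A h := Real.sqrt_nonneg _

theorem sq_wnorm {A : Matrix (Fin n) (Fin n) ℝ} (hA : A.PosSemidef)
    (h : EuclideanSpace ℝ (Fin n)) : wnorm A h ^ 2 = h.ofLp ⬝ᵥ A *ᵥ h.ofLp := by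
  rw [wnorm_eq, Real.sq_sqrt (PosSemidef.dot_nonneg hA _)]

theorem wnorm_smul (A : Matrix (Fin n) (Fin n) ℝ) (c : ℝ) (h : EuclideanSpace ℝ (Fin n)) :
    wnorm A (c • h) = |c| * wnorm A h := by
  rw [wnorm_eq, wnorm_eq, ← Real.sqrt_sq_eq_abs, ← Real.sqrt_mul (sq_nonneg c)]
  simp only [WithLp.ofLp_smul, mulVec_smul, smul_dotProduct, dotProduct_smul, smul_eq_mul]
  ring_nf

theorem wnorm_neg (A : Matrix (Fin n) (Fin n) ℝ) (h : EuclideanSpace ℝ (Fin n)) :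
    wnorm A (-h) = wnorm A h := by
  simpa using wnorm_smul A (-1) h

theorem wnorm_mono {A B : Matrix (Fin n) (Fin n) ℝ} (h : Loewner A B)
    (v : EuclideanSpace ℝ (Fin n)) : wnorm A v ≤ wnorm B v := by
  rw [wnorm_eq, wnorm_eq]
  exact Real.sqrt_le_sqrt (h.dot_le _)

theorem wnorm_smul_left {c : ℝ} (hc : 0 ≤ c) (A : Matrix (Fin n) (Fin n) ℝ)
    (h : EuclideanSpace ℝ (Fin n)) : wnorm (c • A) h = Real.sqrt c * wnorm A h := by
  rw [wnorm_eq, wnorm_eq, ← Real.sqrt_mul hc, smul_mulVec, dotProduct_smul, smul_eq_mul]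

theorem wnorm_one (h : EuclideanSpace ℝ (Fin n)) : wnorm 1 h = ‖h‖ := by
  rw [wnorm, map_one, norm_eq_sqrt_real_inner]
  rfl

theorem dualNorm_nonneg (A : Matrix (Fin n) (Fin n) ℝ) (h : EuclideanSpace ℝ (Fin n)) :
    0 ≤ dualNorm A h := wnorm_nonneg _ _

theorem inner_eq_dotProduct (v w : EuclideanSpace ℝ (Fin n)) :
    inner ℝ v w = v.ofLp ⬝ᵥ w.ofLp := by
  rw [EuclideanSpace.inner_eq_star_dotProduct, dotProduct_comm]
  rfl

theorem dualNorm_le_of_abs_inner_le {A : Matrix (Fin n) (Fin n) ℝ} (hA : A.PosDef)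
    {y : EuclideanSpace ℝ (Fin n)} {C : ℝ} (hC : 0 ≤ C)
    (h : ∀ v, |inner ℝ v y| ≤ C * wnorm A v) : dualNorm A y ≤ C := by
  rw [dualNorm, wnorm_eq]
  refine Real.sqrt_le_iff.2 ⟨hC, PosDef.dot_inv_le hA (sq_nonneg C) fun v => ?_⟩
  have h1 := h (WithLp.toLp 2 v)
  have h2 := pow_le_pow_left₀ (abs_nonneg _) h1 2
  rwa [mul_pow, sq_wnorm hA.posSemidef, sq_abs, inner_eq_dotProduct, dotProduct_comm] at h2

/-- For `h = G⁻¹ g` and `A ⪯ G`, `‖h‖_A ≤ ‖g‖_G^*`. -/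
theorem wnorm_inv_le_dualNorm {A G : Matrix (Fin n) (Fin n) ℝ} (hG : G.PosDef)
    (h : Loewner A G) (g : EuclideanSpace ℝ (Fin n)) :
    wnorm A (toEuclideanCLM (𝕜 := ℝ) G⁻¹ g) ≤ dualNorm G g := by
  refine (wnorm_mono h _).trans (le_of_eq ?_)
  rw [dualNorm, wnorm_eq, wnorm_eq, ofLp_toEuclideanCLM, PosDef.mulVec_inv_mulVec hG,
    dotProduct_comm]

theorem dualNorm_anti {A G : Matrix (Fin n) (Fin n) ℝ} (hA : A.PosDef)
    (h : Loewner A G) (g : EuclideanSpace ℝ (Fin n)) : dualNorm G g ≤ dualNorm A g :=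
  wnorm_mono (h.inv hA) g

theorem dualNorm_le_norm {A : Matrix (Fin n) (Fin n) ℝ} {μ : ℝ} (hμ : 0 < μ)
    (h : Loewner (μ • 1) A) (g : EuclideanSpace ℝ (Fin n)) :
    dualNorm A g ≤ ‖g‖ / Real.sqrt μ := by
  refine (wnorm_mono (inv_loewner_of_smul_one hμ h) g).trans (le_of_eq ?_)
  rw [wnorm_smul_left (by positivity), wnorm_one, Real.sqrt_inv]
  ring

theorem norm_inv_le {G : Matrix (Fin n) (Fin n) ℝ} {μ : ℝ} (hμ : 0 < μ)
    (h : Loewner (μ • 1) G) (g : EuclideanSpace ℝ (Fin n)) :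
    ‖toEuclideanCLM (𝕜 := ℝ) G⁻¹ g‖ ≤ ‖g‖ / μ := by
  have hG : G.PosDef := h.posDef (PosDef.one.smul hμ)
  have h1 := (wnorm_inv_le_dualNorm hG h g).trans (dualNorm_le_norm hμ h g)
  rw [wnorm_smul_left hμ.le, wnorm_one, le_div_iff₀ (Real.sqrt_pos.2 hμ)] at h1
  rwa [mul_right_comm, Real.mul_self_sqrt hμ.le, mul_comm, ← le_div_iff₀ hμ] at h1

theorem wnorm_le_norm {A : Matrix (Fin n) (Fin n) ℝ} {ω : ℝ} (hω : 0 ≤ ω)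
    (h : Loewner A (ω • 1)) (v : EuclideanSpace ℝ (Fin n)) :
    wnorm A v ≤ Real.sqrt ω * ‖v‖ := by
  refine (wnorm_mono h v).trans (le_of_eq ?_)
  rw [wnorm_smul_left hω, wnorm_one]

/-- If `A ⪯ G ⪯ (1 + s) A`, then `I - A G⁻¹` contracts the dual norm by `s / (1 + s)`. -/
theorem abs_inner_residual_le {A G : Matrix (Fin n) (Fin n) ℝ} (hA : A.PosDef)
    (h : Loewner A G) {s : ℝ} (hs : 0 ≤ s) (hG : Loewner G ((1 + s) • A))
    (g v : EuclideanSpace ℝ (Fin n)) :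
    |inner ℝ v (g - toEuclideanCLM (𝕜 := ℝ) A (toEuclideanCLM (𝕜 := ℝ) G⁻¹ g))| ≤
      s / (1 + s) * dualNorm A g * wnorm A v := by
  have hGp := h.posDef hA
  have hS : Loewner G⁻¹ A⁻¹ := h.inv hA
  have hT := hG.inv_loewner_smul_inv hGp hA hs
  have hs1 : 0 < 1 + s := by linarith
  -- The pairing with `v` is the form `A⁻¹ - G⁻¹` between `Av` and `g`, and `0 ⪯ A⁻¹ - G⁻¹ ⪯ s/(1+s)
  -- A⁻¹`.
  have key := sq_dotProduct_mulVec_le (D := A⁻¹ - G⁻¹) (P := A⁻¹) (c := s / (1 + s))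
    (hA.inv.isHermitian.sub hGp.inv.isHermitian) hA.inv.isHermitian
    (fun v => by
      have := hT.dot_le v
      rw [smul_mulVec, dotProduct_smul, smul_eq_mul] at this
      rw [sub_mulVec, dotProduct_sub, div_mul_eq_mul_div, le_div_iff₀ hs1]
      linarith)
    (fun v => by
      have h1 := hS.dot_le v
      have h2 := PosSemidef.dot_nonneg hA.inv.posSemidef v
      have h3 : 0 ≤ s / (1 + s) * (v ⬝ᵥ A⁻¹ *ᵥ v) := by positivity
      rw [sub_mulVec, dotProduct_sub]
      linarith) (A *ᵥ v.ofLp) g.ofLp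
  have e1 : (A *ᵥ v.ofLp) ⬝ᵥ (A⁻¹ - G⁻¹) *ᵥ g.ofLp =
      inner ℝ v (g - toEuclideanCLM (𝕜 := ℝ) A (toEuclideanCLM (𝕜 := ℝ) G⁻¹ g)) := by
    rw [inner_eq_dotProduct, WithLp.ofLp_sub, ofLp_toEuclideanCLM, ofLp_toEuclideanCLM,
      dotProduct_comm, dotProduct_mulVec_comm_of_isHermitian hA.isHermitian, sub_mulVec, mulVec_sub,
      PosDef.mulVec_inv_mulVec hA]
  have e2 : (A *ᵥ v.ofLp) ⬝ᵥ A⁻¹ *ᵥ (A *ᵥ v.ofLp) = v.ofLp ⬝ᵥ A *ᵥ v.ofLp := by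
    rw [PosDef.inv_mulVec_mulVec hA, dotProduct_comm]
  rw [e1, e2, ← sq_wnorm hA.posSemidef, ← sq_wnorm hA.inv.posSemidef] at key
  refine abs_le_of_sq_le_sq ?_ ?_
  · unfold dualNorm
    nlinarith
  · have := dualNorm_nonneg A g
    have := wnorm_nonneg A v
    positivity

/-! ### One step of the method -/

variable {f : EuclideanSpace ℝ (Fin n) → ℝ} {μ ω L M : ℝ}

theorem RegularObjective.posDef (hf : RegularObjective f μ ω L) (hμ : 0 < μ)
    (x : EuclideanSpace ℝ (Fin n)) : (hess f x).PosDef :=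
  (hf.lower x).posDef (PosDef.one.smul hμ)

theorem toEuclideanCLM_hess (f : EuclideanSpace ℝ (Fin n) → ℝ) (x v : EuclideanSpace ℝ (Fin n)) :
    toEuclideanCLM (𝕜 := ℝ) (hess f x) v = fderiv ℝ (∇ f) x v := by
  have e : v = ∑ j, v.ofLp j • EuclideanSpace.single j (1 : ℝ) := by
    ext i
    simp [Finset.sum_apply, Pi.single_apply]
  conv_rhs => rw [e, map_sum]
  ext i
  simp [ofLp_toEuclideanCLM, mulVec, dotProduct, hess, mul_comm]

/-- Taylor's estimate for the gradient tested against a vector. -/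
theorem abs_inner_gradient_sub_le (hf : RegularObjective f μ ω L)
    (x d v : EuclideanSpace ℝ (Fin n)) (C : ℝ)
    (h : ∀ t ∈ Set.Ico (0 : ℝ) 1,
      |inner ℝ v (toEuclideanCLM (𝕜 := ℝ) (hess f (x + t • d) - hess f x) d)| ≤ t * C) :
    |inner ℝ v (∇ f (x + d) - ∇ f x - toEuclideanCLM (𝕜 := ℝ) (hess f x) d)| ≤ C / 2 := by
  set F : ℝ → ℝ := fun t =>
    inner ℝ v (∇ f (x + t • d) - ∇ f x - t • toEuclideanCLM (𝕜 := ℝ) (hess f x) d) with hF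
  have hder : ∀ t, HasDerivAt F
      (inner ℝ v (toEuclideanCLM (𝕜 := ℝ) (hess f (x + t • d) - hess f x) d)) t := by
    intro t
    have h1 : HasDerivAt (fun t : ℝ => x + t • d) d t := by
      simpa using ((hasDerivAt_id t).smul_const d).const_add x
    have h2 : HasDerivAt (fun t : ℝ => ∇ f (x + t • d)) (fderiv ℝ (∇ f) (x + t • d) d) t :=
      (hf.diff_grad (x + t • d)).hasFDerivAt.comp_hasDerivAt (f := fun t : ℝ => x + t • d) t h1
    have h3 : HasDerivAt (fun t : ℝ => t • toEuclideanCLM (𝕜 := ℝ) (hess f x) d)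
        (toEuclideanCLM (𝕜 := ℝ) (hess f x) d) t := by
      simpa using (hasDerivAt_id t).smul_const (toEuclideanCLM (𝕜 := ℝ) (hess f x) d)
    have h4 := (h2.sub_const (∇ f x)).sub h3
    rw [← toEuclideanCLM_hess, ← _root_.sub_apply, ← map_sub] at h4
    exact ((innerSL ℝ v).hasFDerivAt.comp_hasDerivAt t h4)
  have hB : ∀ t : ℝ, HasDerivAt (fun t : ℝ => C / 2 * t ^ 2) (t * C) t := by
    intro t
    exact ((hasDerivAt_pow 2 t).const_mul (C / 2)).congr_deriv (by norm_num; ring)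
  -- Comparison of `F` with `Ct²/2` through their derivatives replaces the integral form of the
  -- remainder.
  have := image_norm_le_of_norm_deriv_right_le_deriv_boundary (a := 0) (b := 1) (f := F)
    (fun t _ => (hder t).continuousAt.continuousWithinAt)
    (fun t _ => (hder t).hasDerivWithinAt) (B := fun t => C / 2 * t ^ 2)
    (B' := fun t => t * C) (by simp [hF]) hB (fun t ht => h t ht)
    (Set.right_mem_Icc.2 zero_le_one)
  simpa [hF] using this

theorem norm_gradient_sub_le (hf : RegularObjective f μ ω L) (x d : EuclideanSpace ℝ (Fin n)) :
    ‖∇ f (x + d) - ∇ f x - toEuclideanCLM (𝕜 := ℝ) (hess f x) d‖ ≤ L / 2 * ‖d‖ ^ 2 := by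
  set e := ∇ f (x + d) - ∇ f x - toEuclideanCLM (𝕜 := ℝ) (hess f x) d with he
  have h1 := abs_inner_gradient_sub_le hf x d e (L * ‖d‖ ^ 2 * ‖e‖) fun t ht => by
    refine (abs_real_inner_le_norm _ _).trans ?_
    have h2 := ContinuousLinearMap.le_of_opNorm_le _ (hf.lipschitz x (x + t • d)) d
    rw [add_sub_cancel_left, norm_smul, Real.norm_of_nonneg ht.1] at h2
    calc _ ≤ ‖e‖ * (L * (t * ‖d‖) * ‖d‖) := by gcongr
      _ = _ := by ring
  rw [← he, real_inner_self_eq_norm_sq, abs_of_nonneg (sq_nonneg _)] at h1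
  rcases (norm_nonneg e).eq_or_lt with h0 | h0
  · have h2 := (norm_nonneg _).trans (hf.lipschitz x (x + d))
    rw [add_sub_cancel_left] at h2
    rw [← h0]
    nlinarith [norm_nonneg d]
  · by_contra! h2
    nlinarith

theorem StronglySelfConcordant.abs_inner_gradient_sub_le (hsc : StronglySelfConcordant f M)
    (hf : RegularObjective f μ ω L) (hμ : 0 < μ) (hM : 0 ≤ M) (x d v : EuclideanSpace ℝ (Fin n)) :
    |inner ℝ v (∇ f (x + d) - ∇ f x - toEuclideanCLM (𝕜 := ℝ) (hess f x) d)| ≤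
      M * wnorm (hess f x) d ^ 2 / 2 * wnorm (hess f x) v := by
  have hA := hf.posDef hμ x
  refine (AGQN.abs_inner_gradient_sub_le hf x d v
    (M * wnorm (hess f x) d ^ 2 * wnorm (hess f x) v) fun t ht => ?_).trans (le_of_eq (by ring))
  have h1 := hsc x (x + t • d) x x
  have h2 := hsc (x + t • d) x x x
  rw [add_sub_cancel_left, wnorm_smul, abs_of_nonneg ht.1] at h1
  rw [sub_add_cancel_left, wnorm_neg, wnorm_smul, abs_of_nonneg ht.1] at h2
  have key := sq_dotProduct_mulVec_le (c := M * (t * wnorm (hess f x) d))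
    ((hf.posDef hμ (x + t • d)).isHermitian.sub hA.isHermitian) hA.isHermitian
    (fun v => by simpa [smul_mulVec] using h1.dot_le v)
    (fun v => by
      have := h2.dot_le v
      rw [smul_mulVec, dotProduct_smul, smul_eq_mul] at this
      rw [sub_mulVec, dotProduct_sub] at this ⊢
      linarith) v.ofLp d.ofLp
  rw [← inner_toEuclideanCLM, ← sq_wnorm hA.posSemidef, ← sq_wnorm hA.posSemidef] at key
  refine abs_le_of_sq_le_sq ?_ ?_
  · nlinarith
  · have := wnorm_nonneg (hess f x) v
    have := ht.1
    positivity

theorem gradient_step_eq (A B : Matrix (Fin n) (Fin n) ℝ) (g y : EuclideanSpace ℝ (Fin n)) :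
    y = (g - toEuclideanCLM (𝕜 := ℝ) A (toEuclideanCLM (𝕜 := ℝ) B g)) +
      (y - g - toEuclideanCLM (𝕜 := ℝ) A (-toEuclideanCLM (𝕜 := ℝ) B g)) := by
  rw [map_neg]
  abel

/-- This keeps the Euclidean gradient norm from growing. The factor `√κ` is the price of measuring
the residual, contracted in the dual norm of `A`, in the Euclidean norm. -/
theorem norm_gradient_step_le (hf : RegularObjective f μ ω L) (hμ : 0 < μ) (hω : 0 ≤ ω)
    (hL : 0 ≤ L) {x : EuclideanSpace ℝ (Fin n)} {G : Matrix (Fin n) (Fin n) ℝ}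
    (h : Loewner (hess f x) G) {s : ℝ} (hs : 0 ≤ s) (hG : Loewner G ((1 + s) • hess f x)) :
    ‖∇ f (x - toEuclideanCLM (𝕜 := ℝ) G⁻¹ (∇ f x))‖ ≤
      (s / (1 + s) * Real.sqrt (ω / μ) + beta f μ L x) * ‖∇ f x‖ := by
  set g := ∇ f x
  set A := hess f x
  set d := -toEuclideanCLM (𝕜 := ℝ) G⁻¹ g with hd
  rw [sub_eq_add_neg, ← hd]
  have e := gradient_step_eq A G⁻¹ g (∇ f (x + d))
  rw [e]
  refine (norm_add_le _ _).trans ?_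
  rw [add_mul]
  refine add_le_add ?_ ?_
  · set y := g - toEuclideanCLM (𝕜 := ℝ) A (toEuclideanCLM (𝕜 := ℝ) G⁻¹ g)
    have h1 := abs_inner_residual_le (hf.posDef hμ x) h hs hG g y
    rw [real_inner_self_eq_norm_sq, abs_of_nonneg (sq_nonneg _)] at h1
    have h2 := dualNorm_le_norm hμ (hf.lower x) g
    have h3 := wnorm_le_norm hω (hf.upper x) y
    have h4 : ‖y‖ ^ 2 ≤ s / (1 + s) * (‖g‖ / Real.sqrt μ) * (Real.sqrt ω * ‖y‖) :=
      h1.trans (by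
        have := wnorm_nonneg (hess f x) y
        gcongr)
    rw [Real.sqrt_div hω]
    have h5 : s / (1 + s) * (‖g‖ / Real.sqrt μ) * (Real.sqrt ω * ‖y‖) =
      s / (1 + s) * (Real.sqrt ω / Real.sqrt μ) * ‖g‖ * ‖y‖ := by ring
    rw [h5] at h4
    rcases (norm_nonneg y).eq_or_lt with h0 | h0
    · rw [← h0]
      positivity
    · by_contra! h6
      nlinarith
  · refine (norm_gradient_sub_le hf x d).trans ?_
    have h1 : ‖d‖ ≤ ‖g‖ / μ := by
      rw [hd, norm_neg]
      exact norm_inv_le hμ ((hf.lower x).trans h) g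
    calc L / 2 * ‖d‖ ^ 2 ≤ L / 2 * (‖g‖ / μ) ^ 2 := by gcongr
      _ = _ := by
        rw [beta]
        change _ = L * ‖g‖ / (2 * μ ^ 2) * ‖g‖
        field_simp

theorem hess_loewner_smul_hess (hsc : StronglySelfConcordant f M)
    (x y : EuclideanSpace ℝ (Fin n)) :
    Loewner (hess f x) ((1 + M * wnorm (hess f x) (y - x)) • hess f y) := by
  have h := hsc y x x y
  rw [← neg_sub y x, wnorm_neg] at h
  unfold Loewner at h ⊢
  convert h using 1
  module

theorem lam_step_le (hsc : StronglySelfConcordant f M) (hf : RegularObjective f μ ω L)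
    (hμ : 0 < μ) (hM : 0 ≤ M) {x : EuclideanSpace ℝ (Fin n)} {G : Matrix (Fin n) (Fin n) ℝ}
    (h : Loewner (hess f x) G) {s : ℝ} (hs : 0 ≤ s) (hG : Loewner G ((1 + s) • hess f x)) :
    lam f (x - toEuclideanCLM (𝕜 := ℝ) G⁻¹ (∇ f x)) ≤
      Real.sqrt (1 + M * lam f x) * (s / (1 + s) + M * lam f x / 2) * lam f x := by
  have hA := hf.posDef hμ x
  set g := ∇ f x with hg
  set d := -toEuclideanCLM (𝕜 := ℝ) G⁻¹ g with hd
  rw [sub_eq_add_neg, ← hd]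
  have hr0 := wnorm_nonneg (hess f x) d
  have hl0 : 0 ≤ lam f x := dualNorm_nonneg _ _
  have hr : wnorm (hess f x) d ≤ lam f x := by
    rw [hd, wnorm_neg]
    exact (wnorm_inv_le_dualNorm (h.posDef hA) h g).trans (dualNorm_anti hA h g)
  have h1 : dualNorm (hess f x) (∇ f (x + d)) ≤ (s / (1 + s) + M * lam f x / 2) * lam f x := by
    refine dualNorm_le_of_abs_inner_le hA (by positivity) fun v => ?_
    rw [gradient_step_eq (hess f x) G⁻¹ g (∇ f (x + d)), inner_add_right]
    refine (abs_add_le _ _).trans ?_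
    have h2 := abs_inner_residual_le hA h hs hG g v
    have h3 := hsc.abs_inner_gradient_sub_le hf hμ hM x d v
    have h4 : M * wnorm (hess f x) d ^ 2 / 2 * wnorm (hess f x) v ≤
        M * lam f x ^ 2 / 2 * wnorm (hess f x) v := by
      have := wnorm_nonneg (hess f x) v
      gcongr
    calc _ ≤ s / (1 + s) * lam f x * wnorm (hess f x) v +
          M * lam f x ^ 2 / 2 * wnorm (hess f x) v := add_le_add h2 (h3.trans h4)
      _ = _ := by ring
  -- Change of metric: the inverse Hessian grows by at most `1 + M‖d‖_A`, hence the square root in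
  -- the norm.
  have h5 := hess_loewner_smul_hess hsc x (x + d)
  rw [add_sub_cancel_left] at h5
  have h6 := h5.inv_loewner_smul_inv hA (hf.posDef hμ _) (by positivity)
  have h7 := wnorm_mono h6 (∇ f (x + d))
  rw [wnorm_smul_left (by positivity)] at h7
  have h8 : Real.sqrt (1 + M * wnorm (hess f x) d) ≤ Real.sqrt (1 + M * lam f x) := by gcongr
  calc lam f (x + d) ≤ _ := h7
    _ ≤ Real.sqrt (1 + M * lam f x) * ((s / (1 + s) + M * lam f x / 2) * lam f x) :=
        mul_le_mul h8 h1 (wnorm_nonneg _ _) (Real.sqrt_nonneg _)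
    _ = _ := by ring

/-! ### The constants -/

theorem RegularObjective.one_le_div (hf : RegularObjective f μ ω L) (hμ : 0 < μ) (hn : 0 < n) :
    1 ≤ ω / μ := by
  have h := ((hf.lower 0).trans (hf.upper 0)).dot_le (Pi.single ⟨0, hn⟩ 1)
  rw [_root_.one_le_div hμ]
  simpa [smul_mulVec] using h

theorem rho_pos {κ : ℝ} (h : 1 < n * κ) : 0 < rho n κ := by
  rw [rho, sub_pos]
  exact (div_lt_one (by linarith)).2 h

theorem rho_le_one {κ : ℝ} (h : 1 < n * κ) : rho n κ ≤ 1 := by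
  have : 0 < 1 / (n * κ) := by positivity
  rw [rho]
  linarith

theorem half_le_rho {κ : ℝ} (hκ : 1 ≤ κ) (hn : 2 ≤ n) : 1 / 2 ≤ rho n κ := by
  have hn' : (2 : ℝ) ≤ n := by exact_mod_cast hn
  have : 1 / (n * κ) ≤ 1 / 2 := one_div_le_one_div_of_le (by norm_num) (by nlinarith)
  rw [rho]
  linarith

theorem epsZero_pos {κ : ℝ} (hκ : 1 ≤ κ) : 0 < epsZero κ := by
  rw [epsZero]
  exact one_div_pos.2 (by linarith)

theorem epsZero_div {κ : ℝ} (hκ : 1 ≤ κ) : epsZero κ / (1 + epsZero κ) = 1 / (2 * κ) := by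
  have h1 : 2 * κ - 1 ≠ 0 := by linarith
  have h2 : κ ≠ 0 := by linarith
  have h3 : 1 + 1 / (2 * κ - 1) = 2 * κ / (2 * κ - 1) := by
    field_simp
    ring
  rw [epsZero, h3]
  field_simp

theorem div_one_add_mono {s t : ℝ} (hs : 0 ≤ s) (h : s ≤ t) : s / (1 + s) ≤ t / (1 + t) := by
  rw [div_le_div_iff₀ (by linarith) (by linarith)]
  linarith

theorem div_one_add_mul_sqrt_le {κ s : ℝ} (hκ : 1 ≤ κ) (hs : 0 ≤ s) (h : s ≤ epsZero κ) :
    s / (1 + s) * Real.sqrt κ ≤ 1 / 2 := by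
  have h1 : s / (1 + s) ≤ 1 / (2 * κ) := (div_one_add_mono hs h).trans (epsZero_div hκ).le
  have h2 : Real.sqrt κ ≤ κ := Real.sqrt_le_iff.2 ⟨by linarith, by nlinarith⟩
  calc s / (1 + s) * Real.sqrt κ ≤ 1 / (2 * κ) * κ := by gcongr
    _ = 1 / 2 := by field_simp

/-- `c` is nonnegative, and increments `m ≤ c` keep the trace potential below `ε`. -/
theorem cConst_spec {κ : ℝ} (h : 1 < n * κ) (τ : ℕ) {ε : ℝ} (hε : 0 ≤ ε) :
    0 ≤ cConst n κ τ ε ∧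
      rho n κ * ((1 + cConst n κ τ ε) ^ 2 * (rho n κ ^ τ * ε + n) - n) ≤ ε := by
  have hρ := rho_pos h
  have hρ1 := rho_le_one h
  have hn : (0 : ℝ) < n := by
    rcases Nat.eq_zero_or_pos n with rfl | hn
    · norm_num at h
    · exact_mod_cast hn
  have hs : 0 < sigmaTau n κ τ ε := by
    rw [sigmaTau]
    positivity
  have hs' : rho n κ ^ τ * ε + n = sigmaTau n κ τ ε := rfl
  have hpow : rho n κ ^ (τ + 1) ≤ 1 := pow_le_one₀ hρ.le hρ1
  have hpow' : rho n κ ^ (τ + 1) * ε = rho n κ * (sigmaTau n κ τ ε - n) := by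
    rw [sigmaTau, pow_succ]
    ring
  rw [hs']
  set ρ := rho n κ
  set s := sigmaTau n κ τ ε
  have hR := Real.sqrt_pos.2 hρ
  have hRR := Real.mul_self_sqrt hρ.le
  have hT : 0 ≤ (s + n) * (1 - ρ ^ (τ + 1)) * ε :=
    mul_nonneg (mul_nonneg (by positivity) (by linarith)) hε
  have hQ : 0 ≤ ρ * s ^ 2 + (s + n) * (1 - ρ ^ (τ + 1)) * ε := by positivity
  have hQQ := Real.mul_self_sqrt hQ
  have hc : cConst n κ τ ε = -(s / (s + n)) +
    Real.sqrt (ρ * s ^ 2 + (s + n) * (1 - ρ ^ (τ + 1)) * ε) / (Real.sqrt ρ * (s + n)) := rfl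
  set Q := Real.sqrt (ρ * s ^ 2 + (s + n) * (1 - ρ ^ (τ + 1)) * ε) with hQdef
  set R := Real.sqrt ρ
  set c := cConst n κ τ ε
  have hQ' : R * s ≤ Q := by
    rw [hQdef]
    refine Real.le_sqrt_of_sq_le ?_
    nlinarith
  have h1 : R * ((s + n) * c + s) = Q := by
    rw [hc]
    field_simp
    ring
  -- Thus `c` is a root of `ρ((s+n)c² + 2sc) = (1 - ρ^(τ+1))ε`. As `ρ(s-n) = ρ^(τ+1)ε`, the second
  -- claim then holds with slack `ρnc²`.
  have h2 : ρ * ((s + n) * c + s) ^ 2 = ρ * s ^ 2 + (s + n) * (1 - ρ ^ (τ + 1)) * ε := by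
    rw [← hQQ, ← h1, ← hRR]
    ring
  have h3 : ρ * ((s + n) * c ^ 2 + 2 * s * c) = ε - ρ ^ (τ + 1) * ε := by
    have : (s + n) * (ρ * ((s + n) * c ^ 2 + 2 * s * c)) = (s + n) * (ε - ρ ^ (τ + 1) * ε) := by
      linarith
    exact mul_left_cancel₀ (by positivity) this
  refine ⟨?_, ?_⟩
  · rw [hc, neg_add_eq_sub, sub_nonneg, div_le_div_iff₀ (by positivity) (by positivity)]
    nlinarith
  · rw [hpow'] at h3
    have : 0 ≤ ρ * n * c ^ 2 := by positivity
    nlinarith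

/-! ### The iterates -/

variable {τ : ℕ} {x : ℕ → EuclideanSpace ℝ (Fin n)} {G : ℕ → Matrix (Fin n) (Fin n) ℝ}

/-- Small gradients give full steps. -/
theorem IsRun.full_step (hrun : IsRun f μ ω L M τ x G) (hf : RegularObjective f μ ω L)
    (hμ : 0 < μ) (hL : 0 < L) (hM : 0 < M) {k : ℕ} (hG : Loewner (hess f (x k)) (G k))
    (h₁ : M * lam f (x k) ≤ cConst n (ω / μ) τ (epsZero (ω / μ)))
    (h₂ : beta f μ L (x k) ≤ 1 / 4) :
    x (k + 1) = x k - toEuclideanCLM (𝕜 := ℝ) (G k)⁻¹ (∇ f (x k)) := by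
  rw [hrun.step_x k]
  rcases eq_or_ne (∇ f (x k)) 0 with h0 | h0
  · rw [h0, map_zero, smul_zero]
  have hA := hf.posDef hμ (x k)
  have hd : 0 < dualNorm (G k) (∇ f (x k)) := by
    rw [dualNorm, wnorm_eq]
    refine Real.sqrt_pos.2 (PosDef.dot_pos (hG.posDef hA).inv fun h => h0 ?_)
    exact (WithLp.ofLp_eq_zero 2).1 h
  have hb : 0 < beta f μ L (x k) := by
    have := norm_pos_iff.2 h0
    unfold beta
    positivity
  have : stepsize f μ ω L M τ (x k) (G k) = 1 := by
    refine min_eq_right (le_min ?_ ?_)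
    · rw [_root_.one_le_div (by positivity)]
      exact (mul_le_mul_of_nonneg_left (dualNorm_anti hA hG _) hM.le).trans h₁
    · rw [_root_.one_le_div (by positivity)]
      linarith
  rw [this, one_smul]

theorem IsRun.loewner_sigma_succ (hrun : IsRun f μ ω L M τ x G) (hf : RegularObjective f μ ω L)
    (hsc : StronglySelfConcordant f M) (hμ : 0 < μ) (hω : 0 < ω) (hM : 0 < M)
    (hnκ : 1 < n * (ω / μ)) {k : ℕ} (hG : Loewner (hess f (x k)) (G k))
    (hx : x (k + 1) = x k - toEuclideanCLM (𝕜 := ℝ) (G k)⁻¹ (∇ f (x k))) :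
    Loewner (hess f (x (k + 1))) (G (k + 1)) ∧
      sigma (hess f (x (k + 1))) (G (k + 1)) ≤ rho n (ω / μ) * ((1 + M * lam f (x k)) ^ 2 *
        (rho n (ω / μ) ^ τ * sigma (hess f (x k)) (G k) + n) - n) := by
  obtain ⟨K, hK, hK'⟩ := hrun.step_G k
  have hA := hf.posDef hμ (x k)
  have hA' := hf.posDef hμ (x (k + 1))
  have hρ := rho_pos hnκ
  have hr : wnorm (hess f (x k)) (x (k + 1) - x k) ≤ lam f (x k) := by
    rw [hx, sub_sub_cancel_left, wnorm_neg]
    exact (wnorm_inv_le_dualNorm (hG.posDef hA) hG _).trans (dualNorm_anti hA hG _)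
  have hr0 := wnorm_nonneg (hess f (x k)) (x (k + 1) - x k)
  have h1 := hess_loewner_smul_hess hsc (x k) (x (k + 1))
  have h2 : Loewner (hess f (x (k + 1)))
      ((1 + M * wnorm (hess f (x k)) (x (k + 1) - x k)) • K) := by
    have h3 := hsc (x k) (x (k + 1)) (x k) (x k)
    have h4 : Loewner (hess f (x (k + 1)))
        ((1 + M * wnorm (hess f (x k)) (x (k + 1) - x k)) • hess f (x k)) := by
      unfold Loewner at h3 ⊢
      convert h3 using 1
      module
    exact h4.trans (loewner_smul (hK.loewner hA hG) (by positivity))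
  refine ⟨hK'.loewner hA' h2, ?_⟩
  refine (hK'.sigma_le hμ hω (hf.lower _) (hf.upper _) h2).trans
    (mul_le_mul_of_nonneg_left ?_ hρ.le)
  refine (sigma_smul_le hA hA' (hK.loewner hA hG) (by positivity) h1).trans ?_
  have h5 := hK.sigma_le hμ hω hρ.le (hf.lower _) (hf.upper _) hG
  have h6 := sigma_nonneg hA (hK.loewner hA hG)
  gcongr

theorem IsRun.invariant (hrun : IsRun f μ ω L M τ x G) (hf : RegularObjective f μ ω L)
    (hsc : StronglySelfConcordant f M) (hμ : 0 < μ) (hL : 0 < L) (hM : 0 < M)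
    (hκ : 1 ≤ ω / μ) (hnκ : 1 < n * (ω / μ)) (hG : Loewner (hess f (x 0)) (G 0))
    (hσ : sigma (hess f (x 0)) (G 0) ≤ epsZero (ω / μ))
    (h₁ : ‖∇ f (x 0)‖ ≤ Real.sqrt μ * cConst n (ω / μ) τ (epsZero (ω / μ)) / M)
    (h₂ : ‖∇ f (x 0)‖ ≤ μ ^ 2 / (2 * L)) (k : ℕ) :
    Loewner (hess f (x k)) (G k) ∧ sigma (hess f (x k)) (G k) ≤ epsZero (ω / μ) ∧
      x (k + 1) = x k - toEuclideanCLM (𝕜 := ℝ) (G k)⁻¹ (∇ f (x k)) := by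
  have hω : 0 < ω := by
    rw [_root_.one_le_div hμ] at hκ
    linarith
  have hε := epsZero_pos hκ
  have hs := Real.sqrt_pos.2 hμ
  obtain ⟨hc0, hc⟩ := cConst_spec hnκ τ hε.le
  have hρ := rho_pos hnκ
  have lam_le : ∀ y, ‖∇ f y‖ ≤ ‖∇ f (x 0)‖ →
      M * lam f y ≤ cConst n (ω / μ) τ (epsZero (ω / μ)) := by
    intro y hy
    have h3 : lam f y ≤ ‖∇ f y‖ / Real.sqrt μ := dualNorm_le_norm hμ (hf.lower y) _
    have h4 := hy.trans h₁
    rw [le_div_iff₀ hs] at h3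
    rw [le_div_iff₀ hM] at h4
    have h5 : M * (lam f y * Real.sqrt μ) ≤ M * ‖∇ f y‖ := by gcongr
    have h6 : Real.sqrt μ * (M * lam f y) ≤
      Real.sqrt μ * cConst n (ω / μ) τ (epsZero (ω / μ)) := by linarith
    exact le_of_mul_le_mul_left h6 hs
  have beta_le : ∀ y, ‖∇ f y‖ ≤ ‖∇ f (x 0)‖ → beta f μ L y ≤ 1 / 4 := by
    intro y hy
    have h4 := hy.trans h₂
    rw [le_div_iff₀ (by positivity)] at h4
    rw [beta, div_le_iff₀ (by positivity)]
    linarith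
  -- The induction carries the gradient bound in place of the full step: it yields both stepsize
  -- conditions, hence the full step.
  suffices H : Loewner (hess f (x k)) (G k) ∧ sigma (hess f (x k)) (G k) ≤ epsZero (ω / μ) ∧
      ‖∇ f (x k)‖ ≤ ‖∇ f (x 0)‖ from
    ⟨H.1, H.2.1, hrun.full_step hf hμ hL hM H.1 (lam_le _ H.2.2) (beta_le _ H.2.2)⟩
  induction k with
  | zero => exact ⟨hG, hσ, le_rfl⟩
  | succ k ih =>
    obtain ⟨hGk, hσk, hgk⟩ := ih
    have hA := hf.posDef hμ (x k)
    have hx := hrun.full_step hf hμ hL hM hGk (lam_le _ hgk) (beta_le _ hgk)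
    obtain ⟨h3, h4⟩ := hrun.loewner_sigma_succ hf hsc hμ hω hM hnκ hGk hx
    have hσ0 := sigma_nonneg hA hGk
    refine ⟨h3, h4.trans (le_trans ?_ hc), le_trans ?_ hgk⟩
    · have h5 := lam_le _ hgk
      have h6 : 0 ≤ lam f (x k) := dualNorm_nonneg _ _
      gcongr
    · rw [hx]
      refine (norm_gradient_step_le hf hμ hω.le hL.le hGk hσ0
        (loewner_smul_of_sigma hA hGk)).trans ?_
      -- The value of `ε₀` makes the residual factor at most `1/2`; with `β ≤ 1/4` the total stays
      -- below 1.
      have h5 := div_one_add_mul_sqrt_le hκ hσ0 hσk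
      have h6 := beta_le _ hgk
      nlinarith [norm_nonneg (∇ f (x k))]

/-! ### Scalar recursions -/

theorem linear_factor_le {s l : ℝ} (hs0 : 0 ≤ s) (hs : s ≤ 1) (hl0 : 0 ≤ l) (hl : l ≤ 1 / 4) :
    Real.sqrt (1 + l) * (s / (1 + s) + l / 2) ≤ 3 / 4 := by
  have h1 : Real.sqrt (1 + l) ≤ 6 / 5 := Real.sqrt_le_iff.2 ⟨by norm_num, by linarith⟩
  have h2 : s / (1 + s) ≤ 1 / 2 := by
    rw [div_le_div_iff₀ (by linarith) (by norm_num)]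
    linarith
  have h3 : 0 ≤ s / (1 + s) := by positivity
  -- `6/5 · (1/2 + 1/8) = 3/4`.
  nlinarith [Real.sqrt_nonneg (1 + l)]

theorem sqrt_one_add_mul_le {s l : ℝ} (hs : 0 ≤ s) (hl : 0 ≤ l) :
    Real.sqrt (1 + l) * (s / (1 + s) + l / 2) ≤ (1 + l / 2) * (s + l / 2) := by
  have h1 : Real.sqrt (1 + l) ≤ 1 + l / 2 := Real.sqrt_le_iff.2 ⟨by linarith, by nlinarith⟩
  have h2 : s / (1 + s) ≤ s := div_le_self hs (by linarith)
  gcongr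

/-- One step of the decay of the potential `s + 4 ν l`. -/
theorem potential_step {ν ρ θ s l s' l' : ℝ} {τ : ℕ} (hν : 2 ≤ ν) (hρ : 1 / 2 ≤ ρ)
    (hθ₁ : ρ ^ (τ + 1) ≤ θ) (hθ₂ : 3 / 4 * ρ ≤ θ) (hs : 0 ≤ s) (hl : 0 ≤ l) (hl' : l ≤ 1 / 100)
    (h₁ : s' ≤ ρ * ((1 + l) ^ 2 * (ρ ^ τ * s + ν) - ν))
    (h₂ : l' ≤ (1 + l / 2) * (s + l / 2) * l) :
    s' + 4 * ν * l' ≤ θ * ((1 + (12 * ν + 2) * l) * (s + 4 * ν * l)) := by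
  -- This lower bound lets terms that carry no `ρ` be written as multiples of `θ`: `4ν ≤ θ · 32ν/3`.
  -- The term linear in `l` created by `s'` is about `8νl/3`, which the weight `4ν` absorbs.
  have hθ : 3 / 8 ≤ θ := by linarith
  have e1 : s' ≤ θ * ((1 + 201 / 100 * l) * s) + θ * (201 / 75 * ν * l) := by
    have a1 : ρ * ((1 + l) ^ 2 * (ρ ^ τ * s + ν) - ν) =
        ρ ^ (τ + 1) * ((1 + l) ^ 2 * s) + ρ * (ν * ((2 + l) * l)) := by ring
    have a2 : (1 + l) ^ 2 ≤ 1 + 201 / 100 * l := by nlinarith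
    have a3 : ρ ≤ 4 / 3 * θ := by linarith
    have a4 : 2 + l ≤ 201 / 100 := by linarith
    calc s' ≤ _ := h₁
      _ = _ := a1
      _ ≤ θ * ((1 + 201 / 100 * l) * s) + 4 / 3 * θ * (ν * (201 / 100 * l)) := by gcongr
      _ = _ := by ring
  have e2 : 4 * ν * l' ≤ θ * (32 / 3 * ν * (201 / 200 * (s + l / 2) * l)) := by
    have a1 : (1 + l / 2) ≤ 201 / 200 := by linarith
    have a2 : 4 * ν ≤ θ * (32 / 3 * ν) := by nlinarith
    calc 4 * ν * l' ≤ 4 * ν * (201 / 200 * (s + l / 2) * l) := by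
          refine mul_le_mul_of_nonneg_left (h₂.trans ?_) (by linarith)
          gcongr
      _ ≤ θ * (32 / 3 * ν) * (201 / 200 * (s + l / 2) * l) := by gcongr
      _ = _ := by ring
  have hνl : 0 ≤ ν * l := by positivity
  have hsl : 0 ≤ s * l := by positivity
  have e3 : (1 + 201 / 100 * l) * s + 201 / 75 * ν * l +
      32 / 3 * ν * (201 / 200 * (s + l / 2) * l) ≤ (1 + (12 * ν + 2) * l) * (s + 4 * ν * l) := by
    have b1 : 201 / 100 * (s * l) + 32 / 3 * (201 / 200) * (ν * (s * l)) ≤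
        12 * (ν * (s * l)) + 2 * (s * l) := by nlinarith
    have b2 : 201 / 75 * (ν * l) + 32 / 3 * (201 / 400) * (ν * l * l) ≤ 4 * (ν * l) := by
      nlinarith
    have b3 : 0 ≤ (12 * ν + 2) * l * (4 * (ν * l)) := by positivity
    nlinarith
  calc s' + 4 * ν * l' ≤ _ := add_le_add e1 e2
    _ = θ * ((1 + 201 / 100 * l) * s + 201 / 75 * ν * l +
      32 / 3 * ν * (201 / 200 * (s + l / 2) * l)) := by ring
    _ ≤ _ := mul_le_mul_of_nonneg_left e3 (by linarith)

theorem superlinear_factor_le {ν ρ θ ε : ℝ} {τ : ℕ} (hν : 2 ≤ ν) (hρ : 1 / 2 ≤ ρ)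
    (hθ₁ : ρ ^ (τ + 1) ≤ θ) (hθ₂ : 3 / 4 * ρ ≤ θ) {s l : ℕ → ℝ} (hs : ∀ k, 0 ≤ s k)
    (hl : ∀ k, 0 ≤ l k) (hs0 : s 0 ≤ ε) (hl0 : l 0 ≤ Real.log 2 / (8 * (6 * ν + 1)))
    (h₁ : ∀ k, s (k + 1) ≤ ρ * ((1 + l k) ^ 2 * (ρ ^ τ * s k + ν) - ν))
    (h₂ : ∀ k, l (k + 1) ≤ Real.sqrt (1 + l k) * (s k / (1 + s k) + l k / 2) * l k)
    (h₃ : ∀ k, l (k + 1) ≤ 3 / 4 * l k) (k : ℕ) :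
    Real.sqrt (1 + l k) * (s k / (1 + s k) + l k / 2) ≤
      θ ^ k * (2 * (ε + ν * Real.log 2 / (12 * ν + 2))) := by
  have hθ : 0 ≤ θ := by linarith
  have hp : 0 < 12 * ν + 2 := by linarith
  have hgeo : ∀ k, l k ≤ (3 / 4) ^ k * l 0 := by
    intro k
    induction k with
    | zero => simp
    | succ k ih =>
      rw [pow_succ']
      linarith [h₃ k]
  have hsmall : ∀ k, l k ≤ 1 / 100 := by
    intro k
    have a1 : (3 / 4 : ℝ) ^ k ≤ 1 := pow_le_one₀ (by norm_num) (by norm_num)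
    have a2 : Real.log 2 / (8 * (6 * ν + 1)) ≤ 1 / 100 := by
      rw [div_le_iff₀ (by linarith)]
      linarith [Real.log_two_lt_d9]
    nlinarith [hgeo k, hl 0]
  have hexp : ∀ k, 1 + (12 * ν + 2) * l k ≤ Real.exp ((12 * ν + 2) * l 0 * (3 / 4) ^ k) := by
    intro k
    have a1 : (12 * ν + 2) * l k ≤ (12 * ν + 2) * l 0 * (3 / 4) ^ k := by
      rw [mul_assoc, mul_comm (l 0)]
      exact mul_le_mul_of_nonneg_left (hgeo k) hp.le
    linarith [Real.add_one_le_exp ((12 * ν + 2) * l 0 * (3 / 4) ^ k)]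
  -- The exponents add up as the geometric series `∑_{j<k} (3/4)^j = 4(1 - (3/4)^k)`.
  have hsum : ∀ k : ℕ, Real.exp (4 * ((12 * ν + 2) * l 0) * (1 - (3 / 4) ^ k)) *
      Real.exp ((12 * ν + 2) * l 0 * (3 / 4) ^ k) =
      Real.exp (4 * ((12 * ν + 2) * l 0) * (1 - (3 / 4) ^ (k + 1))) := by
    intro k
    rw [← Real.exp_add]
    congr 1
    ring
  have hpot0 : ∀ k, 0 ≤ s k + 4 * ν * l k := fun k => by
    have := hs k
    have := hl k
    positivity
  have hpot : ∀ k, s k + 4 * ν * l k ≤ θ ^ k * (s 0 + 4 * ν * l 0) *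
      Real.exp (4 * ((12 * ν + 2) * l 0) * (1 - (3 / 4) ^ k)) := by
    intro k
    induction k with
    | zero => simp
    | succ k ih =>
      have a1 := potential_step hν hρ hθ₁ hθ₂ (hs k) (hl k) (hsmall k) (h₁ k)
        ((h₂ k).trans (mul_le_mul_of_nonneg_right (sqrt_one_add_mul_le (hs k) (hl k)) (hl k)))
      have := hpot0 0
      calc _ ≤ _ := a1
        _ ≤ θ * (Real.exp ((12 * ν + 2) * l 0 * (3 / 4) ^ k) *
            (θ ^ k * (s 0 + 4 * ν * l 0) *
              Real.exp (4 * ((12 * ν + 2) * l 0) * (1 - (3 / 4) ^ k)))) := by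
          have := hpot0 k
          have := hexp k
          gcongr
        _ = _ := by
          rw [← hsum k]
          ring
  -- The prefactor `1 + l k / 2` is absorbed as one more term of the series, hence the exponent `k +
  -- 1`.
  have hfin : (1 + l k / 2) * (s k + l k / 2) ≤ θ ^ k * (s 0 + 4 * ν * l 0) *
      Real.exp (4 * ((12 * ν + 2) * l 0) * (1 - (3 / 4) ^ (k + 1))) := by
    have a1 : 1 + l k / 2 ≤ 1 + (12 * ν + 2) * l k := by nlinarith [hl k]
    have a2 : s k + l k / 2 ≤ s k + 4 * ν * l k := by nlinarith [hl k]
    calc (1 + l k / 2) * (s k + l k / 2) ≤ Real.exp ((12 * ν + 2) * l 0 * (3 / 4) ^ k) *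
          (θ ^ k * (s 0 + 4 * ν * l 0) *
            Real.exp (4 * ((12 * ν + 2) * l 0) * (1 - (3 / 4) ^ k))) :=
          mul_le_mul (a1.trans (hexp k)) (a2.trans (hpot k))
            (by linarith [hs k, hl k]) (Real.exp_pos _).le
      _ = _ := by
          rw [← hsum k]
          ring
  -- Since `4(12ν+2) = 8(6ν+1)`, the radius in `hl0` is exactly what bounds the accumulated product
  -- by 2.
  have hlog : 4 * ((12 * ν + 2) * l 0) ≤ Real.log 2 := by
    rw [le_div_iff₀ (by linarith)] at hl0
    linarith
  have htwo : Real.exp (4 * ((12 * ν + 2) * l 0) * (1 - (3 / 4) ^ (k + 1))) ≤ 2 := by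
    rw [← Real.le_log_iff_exp_le (by norm_num)]
    have a1 : (0 : ℝ) < (3 / 4) ^ (k + 1) := by positivity
    have a2 : 0 ≤ 4 * ((12 * ν + 2) * l 0) := by
      have := hl 0
      positivity
    nlinarith
  -- At that radius `4νl₀` becomes the second term of `Φ̄₀`.
  have hphi : s 0 + 4 * ν * l 0 ≤ ε + ν * Real.log 2 / (12 * ν + 2) := by
    have : 4 * ν * l 0 ≤ ν * Real.log 2 / (12 * ν + 2) := by
      rw [le_div_iff₀ hp]
      nlinarith
    linarith
  calc _ ≤ _ := sqrt_one_add_mul_le (hs k) (hl k)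
    _ ≤ _ := hfin
    _ ≤ θ ^ k * (ε + ν * Real.log 2 / (12 * ν + 2)) * 2 := by
      have := (hpot0 0).trans hphi
      gcongr
    _ = _ := by ring

theorem IsRun.lam_succ_le (hrun : IsRun f μ ω L M τ x G) (hf : RegularObjective f μ ω L)
    (hsc : StronglySelfConcordant f M) (hμ : 0 < μ) (hL : 0 < L) (hM : 0 < M)
    (hκ : 1 ≤ ω / μ) (hnκ : 1 < n * (ω / μ)) (hG : Loewner (hess f (x 0)) (G 0))
    (hσ : sigma (hess f (x 0)) (G 0) ≤ epsZero (ω / μ))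
    (h₁ : ‖∇ f (x 0)‖ ≤ Real.sqrt μ * cConst n (ω / μ) τ (epsZero (ω / μ)) / M)
    (h₂ : ‖∇ f (x 0)‖ ≤ μ ^ 2 / (2 * L)) (k : ℕ) :
    lam f (x (k + 1)) ≤ Real.sqrt (1 + M * lam f (x k)) *
      (sigma (hess f (x k)) (G k) / (1 + sigma (hess f (x k)) (G k)) + M * lam f (x k) / 2) *
        lam f (x k) := by
  obtain ⟨hGk, -, hx⟩ := hrun.invariant hf hsc hμ hL hM hκ hnκ hG hσ h₁ h₂ k
  have hA := hf.posDef hμ (x k)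
  rw [hx]
  exact lam_step_le hsc hf hμ hM.le hGk (sigma_nonneg hA hGk) (loewner_smul_of_sigma hA hGk)

end AGQN

end

theorem mainTheorem2 {n : ℕ} (f : EuclideanSpace ℝ (Fin n) → ℝ) (μ ω L M : ℝ) (τ : ℕ)
    (hμ : 0 < μ) (hL : 0 < L) (hM : 0 < M)
    (hnκ : 1 < (n : ℝ) * (ω / μ))
    (hf : AGQN.RegularObjective f μ ω L)
    (hsc : AGQN.StronglySelfConcordant f M)
    (x : ℕ → EuclideanSpace ℝ (Fin n)) (G : ℕ → Matrix (Fin n) (Fin n) ℝ)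
    (hrun : AGQN.IsRun f μ ω L M τ x G)
    (hG : AGQN.Loewner (AGQN.hess f (x 0)) (G 0))
    (hσ : AGQN.sigma (AGQN.hess f (x 0)) (G 0) ≤ AGQN.epsZero (ω / μ))
    (hx : ‖gradient f (x 0)‖ ≤
      min (Real.sqrt μ * AGQN.cConst n (ω / μ) τ (AGQN.epsZero (ω / μ)) / M)
        (μ ^ 2 / (2 * L))) :
    (M * AGQN.lam f (x 0) ≤ 1 / 4 →
      ∀ k, AGQN.lam f (x (k + 1)) ≤ 3 / 4 * AGQN.lam f (x k)) ∧
    (2 ≤ n → M * AGQN.lam f (x 0) ≤ Real.log 2 / (8 * (6 * n + 1)) →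
      ∀ k, AGQN.lam f (x (k + 1)) ≤
        (max (AGQN.rho n (ω / μ) ^ (τ + 1)) (3 / 4 * AGQN.rho n (ω / μ))) ^ k *
          (2 * (AGQN.epsZero (ω / μ) + n * Real.log 2 / (12 * n + 2))) *
          AGQN.lam f (x k)) := by
  have hn : 0 < n := by
    rcases Nat.eq_zero_or_pos n with rfl | hn
    · norm_num at hnκ
    · exact hn
  have hκ := hf.one_le_div hμ hn
  have hω : 0 < ω := by
    rw [one_le_div hμ] at hκ
    linarith
  obtain ⟨h₁, h₂⟩ := le_min_iff.1 hx
  have hinv := hrun.invariant hf hsc hμ hL hM hκ hnκ hG hσ h₁ h₂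
  have hstep := hrun.lam_succ_le hf hsc hμ hL hM hκ hnκ hG hσ h₁ h₂
  have hε : AGQN.epsZero (ω / μ) ≤ 1 := by
    rw [AGQN.epsZero, div_le_one (by linarith)]
    linarith
  have hσ0 : ∀ k, 0 ≤ AGQN.sigma (AGQN.hess f (x k)) (G k) := fun k =>
    AGQN.sigma_nonneg (hf.posDef hμ _) (hinv k).1
  have hl0 : ∀ k, 0 ≤ AGQN.lam f (x k) := fun k => AGQN.dualNorm_nonneg _ _
  have linear : M * AGQN.lam f (x 0) ≤ 1 / 4 →
      ∀ k, AGQN.lam f (x (k + 1)) ≤ 3 / 4 * AGQN.lam f (x k) := by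
    intro h0
    have hfactor : ∀ k, M * AGQN.lam f (x k) ≤ 1 / 4 →
        AGQN.lam f (x (k + 1)) ≤ 3 / 4 * AGQN.lam f (x k) := fun k hk =>
      (hstep k).trans (mul_le_mul_of_nonneg_right
        (AGQN.linear_factor_le (hσ0 k) ((hinv k).2.1.trans hε) (mul_nonneg hM.le (hl0 k)) hk)
        (hl0 k))
    have hsmall : ∀ k, M * AGQN.lam f (x k) ≤ 1 / 4 := by
      intro k
      induction k with
      | zero => exact h0
      | succ k ih =>
        refine le_trans (mul_le_mul_of_nonneg_left ?_ hM.le) ih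
        linarith [hfactor k ih, hl0 k]
    exact fun k => hfactor k (hsmall k)
  refine ⟨linear, fun hn2 h0 k => ?_⟩
  have hn2' : (2 : ℝ) ≤ n := by exact_mod_cast hn2
  -- The smaller radius is below `1/4`, so the first claim supplies the geometric decay of `λ` that
  -- the potential argument needs.
  have hlin := linear (h0.trans (by
    rw [div_le_iff₀ (by linarith)]
    linarith [Real.log_two_lt_d9]))
  refine (hstep k).trans (mul_le_mul_of_nonneg_right ?_ (hl0 k))
  refine AGQN.superlinear_factor_le (τ := τ) hn2' (AGQN.half_le_rho hκ hn2)
    (le_max_left _ _) (le_max_right _ _) (s := fun k => AGQN.sigma (AGQN.hess f (x k)) (G k))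
    (l := fun k => M * AGQN.lam f (x k)) hσ0 (fun k => mul_nonneg hM.le (hl0 k)) hσ h0
    (fun k => (hrun.loewner_sigma_succ hf hsc hμ hω hM hnκ (hinv k).1 (hinv k).2.2).2)
    (fun k => ?_) (fun k => ?_) k
  · have := mul_le_mul_of_nonneg_left (hstep k) hM.le
    linarith
  · have := mul_le_mul_of_nonneg_left (hlin k) hM.le
    linarith
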